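/- Let $\Bbbk$ be an algebraically closed field of characteristic zero, let $n\ge 3$ be odd, and let $q\in\Bbbk$ be a primitive $n$th root of unity. Let $\mathsf D_n$ be the Drinfeld double of the Taft algebra: the $\Bbbk$-algebra with generators $a,b,c,d$ and relations $$ba=qab,\quad db=qbd,\quad bc=cb,\quad ca=qac,\quad dc=qcd,\quad da-qad=1-bc,\quad a^n=d^n=0,\quad b^n=c^n=1,$$ with coproduct $\Delta(a)=a\otimes b+1\otimes a$, $\Delta(d)=d\otimes c+1\otimes d$, $\Delta(b)=b\otimes b$, $\Delta(c)=c\otimes c$, and R-matrix $$\mathcal R=\frac1n\sum_{m,s,t=0}^{n-1}\frac{q^{-tm}}{[s]!}\,a^sb^t\otimes c^md^s,\qquad [s]!=\prod_{j=1}^s(1+q+\dots+q^{j-1}).$$ For $1\le \ell\le n$ and $s\in\mathbb Z/n\mathbb Z$ let $\mathsf V(\ell,s)$ be the simple $\mathsf D_n$-module with basis $v_1,\dots,v_\ell$ and action $a v_j=v_{j+1}$ for $j<\ell$, $a v_\ell=0$, $b v_j=q^{s+j-1}v_j$, $c v_j=q^{j-(s+\ell)}v_j$, $d v_1=0$, and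 $d v_j=\frac{(q^{j-1}-1)(1-q^{j-1-\ell})}{q-1}v_{j-1}$ for $j>1$. For a $\mathsf D_n$-module $\mathsf V$, let $\check{\mathsf R}=\sigma\circ\mathcal R$ on $\mathsf V\otimes\mathsf V$, where $\sigma$ interchanges the two factors, and for $1\le i\le k-1$ let $\check{\mathsf R}_i$ be the operator on $\mathsf V^{\otimes k}$ that acts as $\check{\mathsf R}$ on the tensor slots $i,i+1$ and as the identity on the others. **Proposition.** Let $\ell\ge1$ with $2\ell\le n+1$, let $r\in\mathbb Z/n\mathbb Z$, and let $\mathsf V=\mathsf V(\ell,r)$. For $k\ge 2$ and $1\le i\le k-1$, the operator $\check{\mathsf R}_i$ on $\mathsf V^{\otimes k}$ satisfies $$\prod_{\mathsf U}\bigl(\check{\mathsf R}_i^2-c_{\mathsf U}\,\mathrm{id}\bigr)=0,$$ where the product is over the isomorphism classes of simple $\mathsf D_n$-modules $\mathsf U=\mathsf V(a,b)$ ($1\le a\le n$, $b\in\mathbb Z/n\mathbb Z$) occurring as direct summands of the $\mathsf D_n$-module $\mathsf V^{\otimes 2}$, and $$c_{\mathsf U}=q^{\,2r^2+(2r-1)(\ell-1)-b(a+b-1)-\frac12(n-1)(a-1)}\qquad\text{for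 }\mathsf U=\mathsf V(a,b).$$ Moreover, every eigenvalue of $\check{\mathsf R}_i$ on $\mathsf V^{\otimes k}$ is one of the values $\pm\sqrt{c_{\mathsf U}}$, with $\mathsf U$ among these summands. -/

import Mathlib

open scoped TensorProduct

namespace TaftDouble

section QuantumIntegers

variable {k : Type*} [Field k]

/-- The quantum integer `[m] = 1 + q + ⋯ + q^(m-1)`. -/
def qInt (q : k) (m : ℕ) : k := ∑ i ∈ Finset.range m, q ^ i

/-- The quantum factorial `[m]! = [m][m-1]⋯[1]`, with `[0]! = 1`. -/
def qFact (q : k) (m : ℕ) : k := ∏ i ∈ Finset.range m, qInt q (i + 1)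

lemma qInt_add (q : k) (i j : ℕ) : qInt q (i + j) = qInt q i + q ^ i * qInt q j := by
  simp [qInt, Finset.sum_range_add, Finset.mul_sum, pow_add]

lemma qInt_ne_zero {q : k} {n : ℕ} (hq : IsPrimitiveRoot q n) {m : ℕ} (h0 : 0 < m) (hm : m < n) :
    qInt q m ≠ 0 := by
  intro h
  have h1 : (q - 1) * qInt q m = q ^ m - 1 := by
    rw [mul_comm]; exact geom_sum_mul q m
  rw [h, mul_zero] at h1
  exact hq.pow_ne_one_of_pos_of_lt h0.ne' hm (sub_eq_zero.mp h1.symm)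

lemma qFact_ne_zero {q : k} {n : ℕ} (hq : IsPrimitiveRoot q n) {m : ℕ} (hm : m < n) :
    qFact q m ≠ 0 := by
  refine Finset.prod_ne_zero_iff.mpr fun i hi => qInt_ne_zero hq (Nat.succ_pos i) ?_
  have := Finset.mem_range.mp hi
  omega

lemma qFact_succ (q : k) (m : ℕ) : qFact q (m + 1) = qFact q m * qInt q (m + 1) :=
  Finset.prod_range_succ _ _

/-- Auxiliary: the Gaussian binomial coefficients, by their recursion. -/
def qBinom (q : k) : ℕ → ℕ → k
  | _, 0 => 1
  | 0, _ + 1 => 0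
  | m + 1, j + 1 => qBinom q m j + q ^ (j + 1) * qBinom q m (j + 1)

lemma qBinom_of_lt (q : k) : ∀ m j : ℕ, m < j → qBinom q m j = 0
  | _, 0, h => absurd h (by omega)
  | 0, _ + 1, _ => by simp [qBinom]
  | m + 1, j + 1, h => by
    rw [qBinom, qBinom_of_lt q m j (by omega), qBinom_of_lt q m (j + 1) (by omega)]
    simp

lemma qBinom_mul_qFact (q : k) : ∀ i j : ℕ,
    qBinom q (i + j) j * (qFact q i * qFact q j) = qFact q (i + j)
  | i, 0 => by cases i <;> simp [qBinom, qFact]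
  | 0, j + 1 => by
    have h := qBinom_mul_qFact q 0 j
    simp only [Nat.zero_add] at h ⊢
    rw [qBinom, qBinom_of_lt q j (j + 1) (by omega), qFact_succ]
    linear_combination qInt q (j + 1) * h
  | i + 1, j + 1 => by
    have h1 := qBinom_mul_qFact q (i + 1) j
    have h2 := qBinom_mul_qFact q i (j + 1)
    have e1 : i + 1 + j = i + (j + 1) := by omega
    have e2 : i + 1 + (j + 1) = (i + (j + 1)) + 1 := by omega
    have e3 : i + (j + 1) + 1 = (j + 1) + (i + 1) := by omega
    rw [e1] at h1
    rw [e2, qBinom, qFact_succ q (i + (j + 1)), e3, qInt_add q (j + 1) (i + 1)]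
    rw [qFact_succ q i] at h1 ⊢
    rw [qFact_succ q j] at h2 ⊢
    linear_combination qInt q (j + 1) * h1 + q ^ (j + 1) * qInt q (i + 1) * h2

lemma qBinom_eq_zero {q : k} {n : ℕ} (hq : IsPrimitiveRoot q n) {j : ℕ} (h0 : 0 < j) (hj : j < n) :
    qBinom q n j = 0 := by
  have h := qBinom_mul_qFact q (n - j) j
  rw [Nat.sub_add_cancel hj.le] at h
  have hn : qFact q n = 0 := by
    obtain ⟨m, rfl⟩ : ∃ m, n = m + 1 := ⟨n - 1, by omega⟩
    rw [qFact_succ]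
    have h1 : (q - 1) * qInt q (m + 1) = 0 := by
      rw [mul_comm]
      exact (geom_sum_mul q (m + 1)).trans (by rw [hq.pow_eq_one, sub_self])
    have h2 : q - 1 ≠ 0 := sub_ne_zero.mpr (hq.ne_one (by omega))
    rw [(mul_eq_zero.mp h1).resolve_left h2, mul_zero]
  rw [hn] at h
  exact (mul_eq_zero.mp h).resolve_right
    (mul_ne_zero (qFact_ne_zero hq (by omega)) (qFact_ne_zero hq hj))

lemma mul_pow_of_qcomm {A : Type*} [Ring A] [Algebra k A] {q : k} {x y : A}
    (h : y * x = q • (x * y)) (j : ℕ) : y * x ^ j = q ^ j • (x ^ j * y) := by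
  induction j with
  | zero => simp
  | succ j ih =>
    rw [pow_succ, ← mul_assoc, ih, smul_mul_assoc, mul_assoc, h, mul_smul_comm, smul_smul,
      ← pow_succ, mul_assoc]

/-- The quantum binomial theorem. -/
lemma add_pow_of_qcomm {A : Type*} [Ring A] [Algebra k A] {q : k} {x y : A}
    (h : y * x = q • (x * y)) (m : ℕ) :
    (x + y) ^ m = ∑ j ∈ Finset.range (m + 1), qBinom q m j • (x ^ j * y ^ (m - j)) := by
  induction m with
  | zero => simp [qBinom]
  | succ m ih =>
    rw [pow_succ', ih, add_mul, Finset.mul_sum, Finset.mul_sum,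
      Finset.sum_range_succ' _ (m + 1)]
    have hx : ∀ j ∈ Finset.range (m + 1), x * qBinom q m j • (x ^ j * y ^ (m - j))
        = qBinom q m j • (x ^ (j + 1) * y ^ (m + 1 - (j + 1))) := by
      intro j _
      rw [mul_smul_comm, ← mul_assoc, ← pow_succ', Nat.add_sub_add_right]
    have hy : ∀ j ∈ Finset.range (m + 1), y * qBinom q m j • (x ^ j * y ^ (m - j))
        = (q ^ j * qBinom q m j) • (x ^ j * y ^ (m + 1 - j)) := by
      intro j hj
      have := Finset.mem_range.mp hj
      rw [mul_smul_comm, ← mul_assoc, mul_pow_of_qcomm h, smul_mul_assoc, mul_assoc, ← pow_succ',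
        smul_smul, mul_comm (q ^ j), show m - j + 1 = m + 1 - j by omega]
    rw [Finset.sum_congr rfl hx, Finset.sum_congr rfl hy]
    simp only [qBinom, add_smul, Finset.sum_add_distrib]
    rw [add_assoc]
    congr 1
    rw [Finset.sum_range_succ' _ m, Finset.sum_range_succ _ m, qBinom_of_lt q m (m + 1) (by omega)]
    cases m <;> simp [qBinom]

lemma add_pow_eq_of_qcomm {A : Type*} [Ring A] [Algebra k A] {q : k} {n : ℕ} [NeZero n]
    (hq : IsPrimitiveRoot q n) {x y : A} (h : y * x = q • (x * y))
    (hx : x ^ n = 0) (hy : y ^ n = 0) : (x + y) ^ n = 0 := by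
  rw [add_pow_of_qcomm h]
  refine Finset.sum_eq_zero fun j hj => ?_
  rcases Nat.eq_zero_or_pos j with rfl | h0
  · simp [hy]
  rcases Nat.lt_or_ge j n with h1 | h1
  · rw [qBinom_eq_zero hq h0 h1, zero_smul]
  · have : j = n := by have := Finset.mem_range.mp hj; omega
    rw [this, hx, zero_mul, smul_zero]

end QuantumIntegers

/-- The four generators. -/
inductive Gen
  | a | b | c | d

section Algebra

variable {k : Type*} [Field k]

/-- The generators as elements of the free algebra. -/
abbrev gen (k : Type*) [Field k] (g : Gen) : FreeAlgebra k Gen := FreeAlgebra.ι k g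

/-- The defining relations of the Drinfeld double `D_n` of the Taft algebra. -/
inductive Rel (n : ℕ) (q : k) : FreeAlgebra k Gen → FreeAlgebra k Gen → Prop
  | ba : Rel n q (gen k .b * gen k .a) (q • (gen k .a * gen k .b))
  | db : Rel n q (gen k .d * gen k .b) (q • (gen k .b * gen k .d))
  | bc : Rel n q (gen k .b * gen k .c) (gen k .c * gen k .b)
  | ca : Rel n q (gen k .c * gen k .a) (q • (gen k .a * gen k .c))
  | dc : Rel n q (gen k .d * gen k .c) (q • (gen k .c * gen k .d))
  | da : Rel n q (gen k .d * gen k .a - q • (gen k .a * gen k .d)) (1 - gen k .b * gen k .c)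
  | a_pow : Rel n q (gen k .a ^ n) 0
  | d_pow : Rel n q (gen k .d ^ n) 0
  | b_pow : Rel n q (gen k .b ^ n) 1
  | c_pow : Rel n q (gen k .c ^ n) 1

/-- The Drinfeld double `D_n` of the Taft algebra, by generators and relations. -/
abbrev D (n : ℕ) (q : k) : Type _ := RingQuot (Rel n q)

/-- The generators of `D_n`. -/
def D.of (n : ℕ) (q : k) (g : Gen) : D n q := RingQuot.mkAlgHom k (Rel n q) (gen k g)

/-- The relations, for four elements of an arbitrary `k`-algebra. -/
structure Satisfies {A : Type*} [Ring A] [Algebra k A] (n : ℕ) (q : k) (f : Gen → A) : Prop where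
  ba : f .b * f .a = q • (f .a * f .b)
  db : f .d * f .b = q • (f .b * f .d)
  bc : f .b * f .c = f .c * f .b
  ca : f .c * f .a = q • (f .a * f .c)
  dc : f .d * f .c = q • (f .c * f .d)
  da : f .d * f .a - q • (f .a * f .d) = 1 - f .b * f .c
  a_pow : f .a ^ n = 0
  d_pow : f .d ^ n = 0
  b_pow : f .b ^ n = 1
  c_pow : f .c ^ n = 1

lemma D.satisfies (n : ℕ) (q : k) : Satisfies n q (D.of n q) where
  ba := by simpa [D.of] using RingQuot.mkAlgHom_rel k (Rel.ba (n := n) (q := q))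
  db := by simpa [D.of] using RingQuot.mkAlgHom_rel k (Rel.db (n := n) (q := q))
  bc := by simpa [D.of] using RingQuot.mkAlgHom_rel k (Rel.bc (n := n) (q := q))
  ca := by simpa [D.of] using RingQuot.mkAlgHom_rel k (Rel.ca (n := n) (q := q))
  dc := by simpa [D.of] using RingQuot.mkAlgHom_rel k (Rel.dc (n := n) (q := q))
  da := by simpa [D.of] using RingQuot.mkAlgHom_rel k (Rel.da (n := n) (q := q))
  a_pow := by simpa [D.of] using RingQuot.mkAlgHom_rel k (Rel.a_pow (n := n) (q := q))
  d_pow := by simpa [D.of] using RingQuot.mkAlgHom_rel k (Rel.d_pow (n := n) (q := q))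
  b_pow := by simpa [D.of] using RingQuot.mkAlgHom_rel k (Rel.b_pow (n := n) (q := q))
  c_pow := by simpa [D.of] using RingQuot.mkAlgHom_rel k (Rel.c_pow (n := n) (q := q))

/-- The universal property of `D_n`. -/
def D.lift {A : Type*} [Ring A] [Algebra k A] {n : ℕ} {q : k} (f : Gen → A)
    (hf : Satisfies n q f) : D n q →ₐ[k] A :=
  RingQuot.liftAlgHom k ⟨FreeAlgebra.lift k f, by
    rintro x y (_ | _)
    · simpa using hf.ba
    · simpa using hf.db
    · simpa using hf.bc
    · simpa using hf.ca
    · simpa using hf.dc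
    · simpa using hf.da
    · simpa using hf.a_pow
    · simpa using hf.d_pow
    · simpa using hf.b_pow
    · simpa using hf.c_pow⟩

@[simp] lemma D.lift_of {A : Type*} [Ring A] [Algebra k A] {n : ℕ} {q : k} (f : Gen → A)
    (hf : Satisfies n q f) (g : Gen) : D.lift f hf (D.of n q g) = f g := by
  simp [D.lift, D.of]

/-- The coproduct on generators: `Δ(a) = a ⊗ b + 1 ⊗ a`, `Δ(d) = d ⊗ c + 1 ⊗ d`,
`Δ(b) = b ⊗ b`, `Δ(c) = c ⊗ c`. -/
def comulGen (n : ℕ) (q : k) : Gen → D n q ⊗[k] D n q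
  | .a => D.of n q .a ⊗ₜ D.of n q .b + 1 ⊗ₜ D.of n q .a
  | .b => D.of n q .b ⊗ₜ D.of n q .b
  | .c => D.of n q .c ⊗ₜ D.of n q .c
  | .d => D.of n q .d ⊗ₜ D.of n q .c + 1 ⊗ₜ D.of n q .d

lemma comulGen_satisfies {n : ℕ} [NeZero n] {q : k} (hq : IsPrimitiveRoot q n) :
    Satisfies n q (comulGen n q) := by
  have h := D.satisfies n q
  constructor
  · simp [comulGen, mul_add, add_mul, h.ba, TensorProduct.smul_tmul', smul_add]
  · simp [comulGen, mul_add, add_mul, h.db, h.bc, TensorProduct.smul_tmul', smul_add]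
  · simp [comulGen, h.bc]
  · simp [comulGen, mul_add, add_mul, h.ca, h.bc, TensorProduct.smul_tmul', smul_add]
  · simp [comulGen, mul_add, add_mul, h.dc, TensorProduct.smul_tmul', smul_add]
  · have hda : D.of n q .d * D.of n q .a
        = 1 - D.of n q .b * D.of n q .c + q • (D.of n q .a * D.of n q .d) := by
      rw [← h.da]; abel
    simp only [comulGen, mul_add, add_mul, Algebra.TensorProduct.tmul_mul_tmul, one_mul, mul_one,
      hda, h.ca, h.db, ← h.bc, TensorProduct.tmul_add, TensorProduct.add_tmul,
      TensorProduct.tmul_sub, TensorProduct.sub_tmul, TensorProduct.tmul_smul,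
      TensorProduct.smul_tmul', smul_add, Algebra.TensorProduct.one_def]
    abel
  · rw [comulGen, add_comm]
    refine add_pow_eq_of_qcomm (A := D n q ⊗[k] D n q) (x := 1 ⊗ₜ[k] D.of n q .a)
      (y := D.of n q .a ⊗ₜ[k] D.of n q .b) hq ?_ ?_ ?_
    · simp [h.ba]
    · simp [h.a_pow]
    · simp [h.a_pow]
  · refine add_pow_eq_of_qcomm (A := D n q ⊗[k] D n q) (x := D.of n q .d ⊗ₜ[k] D.of n q .c)
      (y := 1 ⊗ₜ[k] D.of n q .d) hq ?_ ?_ ?_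
    · simp [h.dc]
    · simp [h.d_pow]
    · simp [h.d_pow]
  · simp [comulGen, h.b_pow, Algebra.TensorProduct.one_def]
  · simp [comulGen, h.c_pow, Algebra.TensorProduct.one_def]

/-- The coproduct of `D_n`. -/
def comul {n : ℕ} [NeZero n] {q : k} (hq : IsPrimitiveRoot q n) : D n q →ₐ[k] D n q ⊗[k] D n q :=
  D.lift (comulGen n q) (comulGen_satisfies hq)

/-- The R-matrix
`𝓡 = (1/n) ∑_{m,s,t=0}^{n-1} (q^(-tm) / [s]!) a^s b^t ⊗ c^m d^s` of `D_n`. -/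
noncomputable def rMatrix (n : ℕ) (q : k) : D n q ⊗[k] D n q :=
  (1 / (n : k)) • ∑ m ∈ Finset.range n, ∑ s ∈ Finset.range n, ∑ t ∈ Finset.range n,
    (q ^ (-((t : ℤ) * (m : ℤ))) / qFact q s) •
      ((D.of n q .a ^ s * D.of n q .b ^ t) ⊗ₜ[k] (D.of n q .c ^ m * D.of n q .d ^ s))

end Algebra

section Modules

variable {k : Type*} [Field k]

/-- `α_i(ℓ) = (q^i - 1)(1 - q^(i-ℓ)) / (q - 1)`. -/
noncomputable def alpha (q : k) (i ℓ : ℕ) : k :=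
  (q ^ i - 1) * (1 - q ^ ((i : ℤ) - (ℓ : ℤ))) / (q - 1)

/-- The operators by which the generators act on `V(ℓ,s)`. The basis vector `v_j`, `1 ≤ j ≤ ℓ`, is
the standard basis vector with index `j - 1`, so that, with `j : Fin ℓ`,
`a e_j = e_{j+1}`, `b e_j = q^(s+j) e_j`, `c e_j = q^(j+1-(s+ℓ)) e_j`, `d e_j = α_j(ℓ) e_{j-1}`. -/
noncomputable def simpleGen {n : ℕ} (q : k) (ℓ : ℕ) (s : ZMod n) :
    Gen → Module.End k (Fin ℓ → k)
  | .a => (Pi.basisFun k (Fin ℓ)).constr k fun j =>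
      if h : (j : ℕ) + 1 < ℓ then Pi.basisFun k (Fin ℓ) ⟨j + 1, h⟩ else 0
  | .b => (Pi.basisFun k (Fin ℓ)).constr k fun j =>
      q ^ ((s.val : ℤ) + (j : ℕ)) • Pi.basisFun k (Fin ℓ) j
  | .c => (Pi.basisFun k (Fin ℓ)).constr k fun j =>
      q ^ (((j : ℕ) : ℤ) + 1 - ((s.val : ℤ) + (ℓ : ℤ))) • Pi.basisFun k (Fin ℓ) j
  | .d => (Pi.basisFun k (Fin ℓ)).constr k fun j =>
      if 0 < (j : ℕ) then
        alpha q j ℓ • Pi.basisFun k (Fin ℓ) ⟨j - 1, lt_of_le_of_lt (Nat.sub_le _ _) j.isLt⟩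
      else 0

section Basis

variable {n : ℕ} (q : k) (ℓ : ℕ) (s : ZMod n) (j : Fin ℓ)

lemma simpleGen_a : simpleGen q ℓ s .a (Pi.basisFun k (Fin ℓ) j) =
    if h : (j : ℕ) + 1 < ℓ then Pi.basisFun k (Fin ℓ) ⟨j + 1, h⟩ else 0 :=
  Module.Basis.constr_basis _ _ _ _

lemma simpleGen_b : simpleGen q ℓ s .b (Pi.basisFun k (Fin ℓ) j) =
    q ^ ((s.val : ℤ) + (j : ℕ)) • Pi.basisFun k (Fin ℓ) j :=
  Module.Basis.constr_basis _ _ _ _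

lemma simpleGen_c : simpleGen q ℓ s .c (Pi.basisFun k (Fin ℓ) j) =
    q ^ (((j : ℕ) : ℤ) + 1 - ((s.val : ℤ) + (ℓ : ℤ))) • Pi.basisFun k (Fin ℓ) j :=
  Module.Basis.constr_basis _ _ _ _

lemma simpleGen_d : simpleGen q ℓ s .d (Pi.basisFun k (Fin ℓ) j) =
    if 0 < (j : ℕ) then
      alpha q j ℓ • Pi.basisFun k (Fin ℓ) ⟨j - 1, lt_of_le_of_lt (Nat.sub_le _ _) j.isLt⟩
    else 0 :=
  Module.Basis.constr_basis _ _ _ _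

lemma simpleGen_a_pow (m : ℕ) : (simpleGen q ℓ s .a ^ m) (Pi.basisFun k (Fin ℓ) j) =
    if h : (j : ℕ) + m < ℓ then Pi.basisFun k (Fin ℓ) ⟨j + m, h⟩ else 0 := by
  induction m with
  | zero => simp
  | succ m ih =>
    rw [pow_succ', Module.End.mul_apply, ih]
    split_ifs with h1 h2 h2
    · rw [simpleGen_a, dif_pos (show (j : ℕ) + m + 1 < ℓ by omega)]
      rfl
    · rw [simpleGen_a, dif_neg (show ¬ (j : ℕ) + m + 1 < ℓ by omega)]
    · omega
    · exact map_zero _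

lemma simpleGen_d_pow (m : ℕ) (hm : (j : ℕ) < m) :
    (simpleGen q ℓ s .d ^ m) (Pi.basisFun k (Fin ℓ) j) = 0 := by
  induction m generalizing j with
  | zero => omega
  | succ m ih =>
    rw [pow_succ, Module.End.mul_apply, simpleGen_d]
    split_ifs with h1
    · rw [map_smul, ih _ (by simp only; omega), smul_zero]
    · exact map_zero _

lemma simpleGen_b_pow (m : ℕ) : (simpleGen q ℓ s .b ^ m) (Pi.basisFun k (Fin ℓ) j) =
    (q ^ ((s.val : ℤ) + (j : ℕ))) ^ m • Pi.basisFun k (Fin ℓ) j := by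
  induction m with
  | zero => simp
  | succ m ih =>
    rw [pow_succ, Module.End.mul_apply, simpleGen_b, map_smul, ih, smul_smul, ← pow_succ']

lemma simpleGen_c_pow (m : ℕ) : (simpleGen q ℓ s .c ^ m) (Pi.basisFun k (Fin ℓ) j) =
    (q ^ (((j : ℕ) : ℤ) + 1 - ((s.val : ℤ) + (ℓ : ℤ)))) ^ m • Pi.basisFun k (Fin ℓ) j := by
  induction m with
  | zero => simp
  | succ m ih =>
    rw [pow_succ, Module.End.mul_apply, simpleGen_c, map_smul, ih, smul_smul, ← pow_succ']

end Basis

lemma zpow_pow_eq_one {n : ℕ} {q : k} (hq : IsPrimitiveRoot q n) (x : ℤ) : (q ^ x) ^ n = 1 := by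
  rw [← zpow_natCast, ← zpow_mul, mul_comm, zpow_mul, zpow_natCast, hq.pow_eq_one, one_zpow]

lemma alpha_zero (q : k) (ℓ : ℕ) : alpha q 0 ℓ = 0 := by simp [alpha]

lemma alpha_self (q : k) (ℓ : ℕ) : alpha q ℓ ℓ = 0 := by simp [alpha]

lemma alpha_succ {q : k} (h0 : q ≠ 0) (h1 : q ≠ 1) (j ℓ : ℕ) :
    alpha q (j + 1) ℓ - q * alpha q j ℓ = 1 - q ^ (2 * (j : ℤ) + 1 - ℓ) := by
  have h2 : q - 1 ≠ 0 := sub_ne_zero.mpr h1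
  have e1 : q ^ ((j : ℤ) + 1 - ℓ) = q * q ^ j * (q ^ ℓ)⁻¹ := by
    rw [zpow_sub₀ h0, zpow_add₀ h0]; simp [div_eq_mul_inv, mul_comm]
  have e2 : q ^ ((j : ℤ) - ℓ) = q ^ j * (q ^ ℓ)⁻¹ := by
    rw [zpow_sub₀ h0]; simp [div_eq_mul_inv]
  have e3 : q ^ (2 * (j : ℤ) + 1 - ℓ) = q * q ^ j * q ^ j * (q ^ ℓ)⁻¹ := by
    rw [zpow_sub₀ h0, zpow_add₀ h0, two_mul, zpow_add₀ h0]
    simp only [zpow_natCast, zpow_one, div_eq_mul_inv]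
    ring
  simp only [alpha, Nat.cast_add, Nat.cast_one, e1, e2, e3]
  field_simp
  ring

lemma simpleGen_satisfies {n : ℕ} {q : k} (hn : 2 ≤ n) (hq : IsPrimitiveRoot q n) {ℓ : ℕ}
    (hℓ : ℓ ≤ n) (s : ZMod n) : Satisfies n q (simpleGen q ℓ s) := by
  have h0 : q ≠ 0 := hq.ne_zero (by omega)
  have h1 : q ≠ 1 := hq.ne_one (by omega)
  constructor <;> refine (Pi.basisFun k (Fin ℓ)).ext fun j => ?_
  · simp only [Module.End.mul_apply, LinearMap.smul_apply, simpleGen_b, simpleGen_a, map_smul]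
    split_ifs with h
    · rw [simpleGen_b, smul_smul]
      congr 1
      simp only [Nat.cast_add, Nat.cast_one]
      rw [← add_assoc, zpow_add₀ h0 _ 1, zpow_one, mul_comm]
    · simp
  · simp only [Module.End.mul_apply, LinearMap.smul_apply, simpleGen_b, simpleGen_d, map_smul]
    split_ifs with h
    · rw [map_smul, simpleGen_b, smul_smul, smul_smul, smul_smul]
      congr 1
      simp only [Nat.cast_pred h]
      rw [← add_sub_assoc, zpow_sub₀ h0 _ 1, zpow_one]
      field_simp
    · simp
  · simp only [Module.End.mul_apply, simpleGen_b, simpleGen_c, map_smul, smul_smul]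
    rw [mul_comm]
  · simp only [Module.End.mul_apply, LinearMap.smul_apply, simpleGen_c, simpleGen_a, map_smul]
    split_ifs with h
    · rw [simpleGen_c, smul_smul]
      congr 1
      simp only [Nat.cast_add, Nat.cast_one]
      rw [← zpow_one_add₀ h0]
      congr 1
      ring
    · simp
  · simp only [Module.End.mul_apply, LinearMap.smul_apply, simpleGen_c, simpleGen_d, map_smul]
    split_ifs with h
    · rw [map_smul, simpleGen_c, smul_smul, smul_smul, smul_smul]
      congr 1
      simp only [Nat.cast_pred h]
      rw [mul_right_comm, ← zpow_one_add₀ h0]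
      congr 2
      ring
    · simp
  · have key := alpha_succ h0 h1 (j : ℕ) ℓ
    have hbc : (simpleGen q ℓ s .b * simpleGen q ℓ s .c) (Pi.basisFun k (Fin ℓ) j)
        = q ^ (2 * ((j : ℕ) : ℤ) + 1 - ℓ) • Pi.basisFun k (Fin ℓ) j := by
      rw [Module.End.mul_apply, simpleGen_c, map_smul, simpleGen_b, smul_smul, ← zpow_add₀ h0]
      congr 2
      ring
    have hda : (simpleGen q ℓ s .d * simpleGen q ℓ s .a) (Pi.basisFun k (Fin ℓ) j)
        = alpha q (j + 1) ℓ • Pi.basisFun k (Fin ℓ) j := by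
      rw [Module.End.mul_apply, simpleGen_a]
      split_ifs with h
      · rw [simpleGen_d, if_pos (Nat.succ_pos _)]
        rfl
      · have hj : (j : ℕ) + 1 = ℓ := by omega
        rw [map_zero, hj, alpha_self, zero_smul]
    have had : (simpleGen q ℓ s .a * simpleGen q ℓ s .d) (Pi.basisFun k (Fin ℓ) j)
        = alpha q j ℓ • Pi.basisFun k (Fin ℓ) j := by
      rw [Module.End.mul_apply, simpleGen_d]
      split_ifs with h
      · rw [map_smul, simpleGen_a, dif_pos (by simp only; omega)]
        congr 2
        exact Fin.ext (by simp only; omega)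
      · rw [map_zero, show (j : ℕ) = 0 by omega, alpha_zero, zero_smul]
    rw [LinearMap.sub_apply, LinearMap.sub_apply, LinearMap.smul_apply, hda, had, hbc,
      Module.End.one_apply, smul_smul, ← sub_smul, key, sub_smul, one_smul]
  · rw [simpleGen_a_pow, dif_neg (by omega), LinearMap.zero_apply]
  · rw [simpleGen_d_pow _ _ _ _ _ (by omega), LinearMap.zero_apply]
  · rw [simpleGen_b_pow, zpow_pow_eq_one hq, one_smul, Module.End.one_apply]
  · rw [simpleGen_c_pow, zpow_pow_eq_one hq, one_smul, Module.End.one_apply]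

/-- The simple `D_n`-module `V(ℓ,s)`, of dimension `ℓ`, as a representation on `k^ℓ`. -/
noncomputable def simpleModule {n : ℕ} {q : k} (hn : 2 ≤ n) (hq : IsPrimitiveRoot q n) {ℓ : ℕ}
    (hℓ : ℓ ≤ n) (s : ZMod n) : D n q →ₐ[k] Module.End k (Fin ℓ → k) :=
  D.lift (simpleGen q ℓ s) (simpleGen_satisfies hn hq hℓ s)

/-- The componentwise action of `D_n ⊗ D_n` on `V ⊗ W`. -/
noncomputable def outerAction {n : ℕ} {q : k} {V W : Type*} [AddCommGroup V] [Module k V]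
    [AddCommGroup W] [Module k W] (ρ : D n q →ₐ[k] Module.End k V)
    (τ : D n q →ₐ[k] Module.End k W) :
    D n q ⊗[k] D n q →ₐ[k] Module.End k (V ⊗[k] W) :=
  (Module.endTensorEndAlgHom (R := k) (S := k) (A := k)).comp (Algebra.TensorProduct.map ρ τ)

/-- The tensor product of two `D_n`-modules, with `D_n` acting through the coproduct. -/
noncomputable def tensorModule {n : ℕ} [NeZero n] {q : k} (hq : IsPrimitiveRoot q n)
    {V W : Type*} [AddCommGroup V] [Module k V] [AddCommGroup W] [Module k W]
    (ρ : D n q →ₐ[k] Module.End k V) (τ : D n q →ₐ[k] Module.End k W) :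
    D n q →ₐ[k] Module.End k (V ⊗[k] W) :=
  (outerAction ρ τ).comp (comul hq)

/-- The `D_n`-module `U` is isomorphic to a direct summand of the `D_n`-module `W`: there are
`D_n`-linear maps `U → W → U` whose composition is the identity. -/
def IsSummand {n : ℕ} {q : k} {U W : Type*} [AddCommGroup U] [Module k U] [AddCommGroup W]
    [Module k W] (ρ : D n q →ₐ[k] Module.End k U) (τ : D n q →ₐ[k] Module.End k W) : Prop :=
  ∃ (ι : U →ₗ[k] W) (p : W →ₗ[k] U),
    (∀ x : D n q, ι ∘ₗ ρ x = τ x ∘ₗ ι) ∧ (∀ x : D n q, p ∘ₗ τ x = ρ x ∘ₗ p) ∧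
      p ∘ₗ ι = LinearMap.id

open Classical in
/-- The pairs `(a, b)`, `1 ≤ a ≤ n`, `b ∈ ℤ/n`, for which the simple module `V(a,b)` is a summand
of the `D_n`-module `W`. -/
noncomputable def simpleSummands {n : ℕ} [NeZero n] {q : k} (hn : 2 ≤ n)
    (hq : IsPrimitiveRoot q n) {W : Type*} [AddCommGroup W] [Module k W]
    (τ : D n q →ₐ[k] Module.End k W) : Finset (ℕ × ZMod n) :=
  (Finset.Icc 1 n ×ˢ Finset.univ).filter fun U =>
    ∃ h : U.1 ≤ n, IsSummand (simpleModule hn hq h U.2) τ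

/-- `Ř = σ ∘ 𝓡` on `V ⊗ V`, where `σ` is the interchange of the two factors. -/
noncomputable def rCheck {n : ℕ} {q : k} {V : Type*} [AddCommGroup V] [Module k V]
    (ρ : D n q →ₐ[k] Module.End k V) : Module.End k (V ⊗[k] V) :=
  (TensorProduct.comm k V V).toLinearMap ∘ₗ outerAction ρ ρ (rMatrix n q)

/-- `V ⊗ V ≃ V^{⊗2}`. -/
noncomputable def tensorTwo (k : Type*) [Field k] (V : Type*) [AddCommGroup V] [Module k V] :
    V ⊗[k] V ≃ₗ[k] ⨂[k]^2 V :=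
  (TensorProduct.congr (PiTensorProduct.subsingletonEquiv (0 : Fin 1)).symm
    (PiTensorProduct.subsingletonEquiv (0 : Fin 1)).symm).trans
    (TensorPower.mulEquiv (R := k) (M := V) (n := 1) (m := 1))

/-- The identification `V^{⊗(i-1)} ⊗ (V ⊗ V) ⊗ V^{⊗(m-i-1)} ≃ V^{⊗m}`, for `1 ≤ i ≤ m - 1`. -/
noncomputable def splitSlots (k : Type*) [Field k] (V : Type*) [AddCommGroup V] [Module k V]
    {m i : ℕ} (h1 : 1 ≤ i) (h2 : i + 1 ≤ m) :
    ((⨂[k]^(i - 1) V) ⊗[k] (V ⊗[k] V)) ⊗[k] (⨂[k]^(m - i - 1) V) ≃ₗ[k] ⨂[k]^m V :=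
  (TensorProduct.congr
      ((TensorProduct.congr (LinearEquiv.refl k _) (tensorTwo k V)).trans TensorPower.mulEquiv)
      (LinearEquiv.refl k _)).trans
    (TensorPower.mulEquiv.trans
      (TensorPower.cast k V (show i - 1 + 2 + (m - i - 1) = m by omega)))

/-- The operator `id ⊗ ⋯ ⊗ id ⊗ T ⊗ id ⊗ ⋯ ⊗ id` on `V^{⊗m}`, where the endomorphism `T` of
`V ⊗ V` occupies the slots `i` and `i + 1`, `1 ≤ i ≤ m - 1`. -/
noncomputable def atSlots {V : Type*} [AddCommGroup V] [Module k V]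
    {m i : ℕ} (h1 : 1 ≤ i) (h2 : i + 1 ≤ m) (T : Module.End k (V ⊗[k] V)) :
    Module.End k (⨂[k]^m V) :=
  (splitSlots k V h1 h2).conj
    (TensorProduct.map (TensorProduct.map LinearMap.id T) LinearMap.id)

/-- `Ř_i` on `V^{⊗m}`, `1 ≤ i ≤ m - 1`. -/
noncomputable def rCheckAt {n : ℕ} {q : k} {V : Type*} [AddCommGroup V] [Module k V]
    (ρ : D n q →ₐ[k] Module.End k V) {m i : ℕ} (h1 : 1 ≤ i) (h2 : i + 1 ≤ m) :
    Module.End k (⨂[k]^m V) :=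
  atSlots h1 h2 (rCheck ρ)

/-- The pairs `(a, b)` for which `V(a,b)` is a summand of `V(ℓ,r) ⊗ V(ℓ,r)`. -/
noncomputable def squareSummands {n : ℕ} [NeZero n] {q : k} (hn : 2 ≤ n)
    (hq : IsPrimitiveRoot q n) {ℓ : ℕ} (hℓ : ℓ ≤ n) (r : ZMod n) : Finset (ℕ × ZMod n) :=
  simpleSummands hn hq
    (tensorModule hq (simpleModule hn hq hℓ r) (simpleModule hn hq hℓ r))

/-- `c_U = q^(2r² + (2r-1)(ℓ-1) - b(a+b-1) - (n-1)(a-1)/2)` for `U = V(a,b)`, with `n` odd. The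
residues `r` and `b` are represented by integers; as `q^n = 1`, the choice does not matter. -/
noncomputable def cScalar {n : ℕ} (q : k) (ℓ : ℕ) (r : ZMod n) (U : ℕ × ZMod n) : k :=
  q ^ (2 * (r.val : ℤ) ^ 2 + (2 * (r.val : ℤ) - 1) * ((ℓ : ℤ) - 1)
    - (U.2.val : ℤ) * ((U.1 : ℤ) + (U.2.val : ℤ) - 1) - ((n : ℤ) - 1) / 2 * ((U.1 : ℤ) - 1))

end Modules

end TaftDouble

/-!
For two families `f`, `g` of elements of an algebra which satisfy the relations of `D_n` and commute
with each other, the R-matrix formed from `f` and `g` intertwines the coproduct with its opposite.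
Hence `Ř` is `D_n`-linear on `V ⊗ V` for every `D_n`-module `V`.

For `V = V(ℓ,r)` and `0 ≤ i < ℓ` there is up to scalars a unique vector `w_i` of `b`-weight
`q^(2r+i)` in `V ⊗ V` which is killed by `d`, because such a vector is determined by its component
in `v_1 ⊗ V`. It generates a copy of `V(2ℓ-1-2i, 2r+i)`, and as `2ℓ ≤ n + 1` these copies fill
`V ⊗ V`: their sum meets `ker d` in the span of the `w_i`, so it is direct, and the dimensions add
up to `ℓ²`. By uniqueness `Ř w_i = t w_i`. Only the Cartan part of the R-matrix contributes to the
coefficient of `v_{i+1} ⊗ v_1` in `Ř w_i`, which gives `t` and `t² = c_U`.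
-/

namespace TaftDouble

section Generators

variable {k : Type*} [Field k] {M : Type*} [Ring M] [Algebra k M] {n : ℕ} {q : k}

lemma qInt_one_add (q : k) (s : ℕ) : qInt q (s + 1) = 1 + q * qInt q s := by
  rw [add_comm, qInt_add]; simp [qInt]

lemma sub_one_mul_qInt (q : k) (s : ℕ) : (q - 1) * qInt q s = q ^ s - 1 := by
  rw [mul_comm]; exact geom_sum_mul q s

lemma pow_mul_of_qcomm {x y : M} (h : y * x = q • (x * y)) (j : ℕ) :
    y ^ j * x = q ^ j • (x * y ^ j) := by
  have h' : SemiconjBy x (q • y) y := by simp [SemiconjBy, h]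
  simpa [SemiconjBy, smul_pow] using (h'.pow_right j).symm

namespace Satisfies

variable {f : Gen → M}

lemma d_mul_a (h : Satisfies n q f) :
    f .d * f .a = q • (f .a * f .d) + (1 - f .b * f .c) := by
  rw [← h.da]; abel

lemma bc_mul_a (h : Satisfies n q f) :
    f .b * f .c * f .a = q ^ 2 • (f .a * (f .b * f .c)) := by
  rw [mul_assoc, h.ca, mul_smul_comm, ← mul_assoc, h.ba, smul_mul_assoc, smul_smul, ← sq,
    mul_assoc]

lemma d_mul_a_pow (h : Satisfies n q f) (s : ℕ) :
    f .d * f .a ^ (s + 1) = q ^ (s + 1) • (f .a ^ (s + 1) * f .d) +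
      qInt q (s + 1) • (f .a ^ s * (1 - q ^ s • (f .b * f .c))) := by
  induction s with
  | zero => simp [h.d_mul_a, qInt]
  | succ s ih =>
    have bc_right : f .a ^ s * (f .b * f .c) * f .a =
        q ^ 2 • (f .a ^ (s + 1) * (f .b * f .c)) := by
      rw [mul_assoc, h.bc_mul_a, mul_smul_comm, ← mul_assoc, ← pow_succ]
    rw [pow_succ _ (s + 1), ← mul_assoc, ih, add_mul, smul_mul_assoc, mul_assoc _ (f .d),
      h.d_mul_a, qInt_one_add q (s + 1)]
    simp only [mul_add, mul_sub, mul_one, mul_smul_comm, smul_mul_assoc, sub_mul, bc_right,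
      ← pow_succ, ← mul_assoc (f .a ^ (s + 1)) (f .a), smul_sub, smul_add, smul_smul]
    match_scalars
    · ring
    · linear_combination -sub_one_mul_qInt q (s + 1)
    · ring

lemma map {N : Type*} [Ring N] [Algebra k N] (h : Satisfies n q f) (φ : M →ₐ[k] N) :
    Satisfies n q (fun x => φ (f x)) where
  ba := by simpa using congrArg φ h.ba
  db := by simpa using congrArg φ h.db
  bc := by simpa using congrArg φ h.bc
  ca := by simpa using congrArg φ h.ca
  dc := by simpa using congrArg φ h.dc
  da := by simpa using congrArg φ h.da
  a_pow := by simpa using congrArg φ h.a_pow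
  d_pow := by simpa using congrArg φ h.d_pow
  b_pow := by simpa using congrArg φ h.b_pow
  c_pow := by simpa using congrArg φ h.c_pow

end Satisfies

/-- The family in the opposite algebra that exchanges the roles of `a` and `d` and of `b` and `c`.
It reflects the anti-automorphism `a ↔ d`, `b ↔ c` of `D_n`. -/
def opSwap (f : Gen → M) : Gen → Mᵐᵒᵖ
  | .a => .op (f .d)
  | .b => .op (f .c)
  | .c => .op (f .b)
  | .d => .op (f .a)

lemma Satisfies.opSwap {f : Gen → M} (h : Satisfies n q f) : Satisfies n q (opSwap f) := by
  constructor <;>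
    simp only [TaftDouble.opSwap, ← MulOpposite.op_mul, ← MulOpposite.op_smul,
      ← MulOpposite.op_pow, ← MulOpposite.op_sub, ← MulOpposite.op_one, ← MulOpposite.op_zero,
      h.ba, h.db, h.bc, h.ca, h.dc, h.da, h.a_pow, h.b_pow, h.c_pow, h.d_pow]

end Generators

section UniversalR

variable {k : Type*} [Field k] {M : Type*} [Ring M] [Algebra k M] {n : ℕ} {q : k}

/-- The Cartan part `(1/n) ∑_{m,t=0}^{n-1} q^(-tm) x^t y^m` of the R-matrix, for two elements `x`,
`y` of a `k`-algebra in place of `b ⊗ 1` and `1 ⊗ c`. -/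
noncomputable def cartan (n : ℕ) (q : k) (x y : M) : M :=
  (n : k)⁻¹ • ∑ m ∈ Finset.range n, ∑ t ∈ Finset.range n, q⁻¹ ^ (t * m) • (x ^ t * y ^ m)

lemma map_cartan {N : Type*} [Ring N] [Algebra k N] (φ : M →ₐ[k] N) (x y : M) :
    φ (cartan n q x y) = cartan n q (φ x) (φ y) := by
  simp [cartan]

lemma cartan_comm {x y : M} (h : Commute x y) : cartan n q x y = cartan n q y x := by
  simp only [cartan]
  rw [Finset.sum_comm]
  simp only [mul_comm, (h.pow_pow _ _).eq]

lemma cartan_op {x y : M} (h : Commute x y) :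
    cartan n q (MulOpposite.op x) (MulOpposite.op y) = MulOpposite.op (cartan n q x y) := by
  simp [cartan, ← MulOpposite.op_pow, ← MulOpposite.op_mul, (h.pow_pow _ _).eq]

lemma semiconjBy_cartan {d x x' y y' : M} (hx : SemiconjBy d x x') (hy : SemiconjBy d y y') :
    SemiconjBy d (cartan n q x y) (cartan n q x' y') := by
  simp only [SemiconjBy, cartan, mul_smul_comm, smul_mul_assoc, Finset.mul_sum, Finset.sum_mul]
  refine congrArg _ (Finset.sum_congr rfl fun m _ => Finset.sum_congr rfl fun t _ => ?_)
  rw [((hx.pow_right t).mul_right (hy.pow_right m)).eq]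

lemma sum_range_succ_eq_sum_range {N : Type*} [AddCommGroup N] {F : ℕ → N} (h : F n = F 0) :
    ∑ j ∈ Finset.range n, F (j + 1) = ∑ j ∈ Finset.range n, F j := by
  have := Finset.sum_range_succ' F n
  rwa [Finset.sum_range_succ, h, add_left_inj, eq_comm] at this

lemma cartan_smul_left [NeZero n] (hq : IsPrimitiveRoot q n) (x : M) {y : M} (hy : y ^ n = 1) :
    cartan n q (q • x) y = cartan n q x y * y := by
  let F : ℕ → M := fun m => ∑ t ∈ Finset.range n, (q⁻¹ ^ (t * m) * q ^ t) • (x ^ t * y ^ m)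
  have periodic : F n = F 0 := by
    have hone (t : ℕ) : q⁻¹ ^ (t * n) = 1 := by
      rw [mul_comm, pow_mul, hq.inv.pow_eq_one, one_pow]
    simp [F, hy, hone, -inv_pow]
  have cancel (t m : ℕ) : q⁻¹ ^ (t * (m + 1)) * q ^ t = q⁻¹ ^ (t * m) := by
    rw [Nat.mul_succ, pow_add, mul_assoc, ← mul_pow, inv_mul_cancel₀ (hq.ne_zero (NeZero.ne n)),
      one_pow, mul_one]
  have hF := sum_range_succ_eq_sum_range periodic
  simp only [F, cancel] at hF
  simp only [cartan, smul_mul_assoc, Finset.sum_mul, smul_pow, smul_smul,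
    mul_assoc, ← pow_succ, hF]

lemma cartan_smul_right [NeZero n] (hq : IsPrimitiveRoot q n) {x y : M} (hx : x ^ n = 1)
    (h : Commute x y) : cartan n q x (q • y) = cartan n q x y * x := by
  rw [cartan_comm (h.smul_right q), cartan_smul_left hq y hx, cartan_comm h]

lemma cartan_one_left [NeZero n] (hq : IsPrimitiveRoot q n) (y : M) : cartan n q 1 y = 1 := by
  have hn : (n : k) ≠ 0 := hq.neZero'.out
  have orthogonality : ∀ m ∈ Finset.range n, m ≠ 0 →
      ∑ t ∈ Finset.range n, q⁻¹ ^ (t * m) • ((1 : M) ^ t * y ^ m) = 0 := by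
    intro m hm h0
    have hne : q⁻¹ ^ m - 1 ≠ 0 :=
      sub_ne_zero.mpr (hq.inv.pow_ne_one_of_pos_of_lt h0 (Finset.mem_range.mp hm))
    have hgeom : (∑ t ∈ Finset.range n, (q⁻¹ ^ m) ^ t) * (q⁻¹ ^ m - 1) = 0 := by
      rw [geom_sum_mul, ← pow_mul, mul_comm, pow_mul, hq.inv.pow_eq_one, one_pow, sub_self]
    simp only [one_pow, one_mul, ← Finset.sum_smul, mul_comm _ m, pow_mul,
      (mul_eq_zero.mp hgeom).resolve_right hne, zero_smul]
  rw [cartan, Finset.sum_eq_single_of_mem 0 (Finset.mem_range.mpr (NeZero.pos n)) orthogonality]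
  simp [hn, ← Nat.cast_smul_eq_nsmul k]

lemma cartan_pow_left [NeZero n] (hq : IsPrimitiveRoot q n) {y : k} (hy : y ^ n = 1) (u : ℕ) :
    cartan n q (q ^ u) y = y ^ u := by
  induction u with
  | zero => simpa using cartan_one_left hq y
  | succ u ih => rw [pow_succ', ← smul_eq_mul q, cartan_smul_left hq _ hy, ih, pow_succ]

/-- The summand `(1/[s]!) a₁^s K d₂^s` of the R-matrix, with `K` its Cartan part, where `a₁, b₁, …`
and `a₂, b₂, …` are the members of the families `f` and `g`. -/
noncomputable def universalRTerm (n : ℕ) (q : k) (f g : Gen → M) (s : ℕ) : M :=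
  (qFact q s)⁻¹ • (f .a ^ s * cartan n q (f .b) (g .c) * g .d ^ s)

/-- The R-matrix with the generators in the two factors of `D_n ⊗ D_n` replaced by two families `f`
and `g` of elements of a `k`-algebra. -/
noncomputable def universalR (n : ℕ) (q : k) (f g : Gen → M) : M :=
  ∑ s ∈ Finset.range n, universalRTerm n q f g s

/-- The defect by which `d₁` and `d₂` fail to intertwine a single summand of `universalR`. -/
noncomputable def universalRDefect (n : ℕ) (q : k) (f g : Gen → M) (s : ℕ) : M :=
  (qFact q s)⁻¹ • (f .a ^ s * (1 - q ^ s • (f .b * f .c)) * cartan n q (f .b) (g .c) *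
    g .d ^ (s + 1))

lemma map_universalR {N : Type*} [Ring N] [Algebra k N] (φ : M →ₐ[k] N) (f g : Gen → M) :
    φ (universalR n q f g) = universalR n q (fun x => φ (f x)) (fun x => φ (g x)) := by
  simp [universalR, universalRTerm, map_cartan]

variable {f g : Gen → M}

lemma universalR_opSwap (hbc : Commute (f .b) (g .c)) :
    universalR n q (opSwap g) (opSwap f) = MulOpposite.op (universalR n q f g) := by
  have hK : cartan n q (.op (g .c)) (.op (f .b)) = MulOpposite.op (cartan n q (f .b) (g .c)) := by
    rw [← cartan_op hbc, cartan_comm hbc.op]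
  simp only [universalR, universalRTerm, opSwap, hK, ← MulOpposite.op_pow, ← MulOpposite.op_mul,
    ← MulOpposite.op_smul, ← Finset.op_sum, mul_assoc]

lemma universalR_mul_b (hf : Satisfies n q f) (hg : Satisfies n q g)
    (hfg : ∀ x y, Commute (f x) (g y)) :
    universalR n q f g * (f .b * g .b) = f .b * g .b * universalR n q f g := by
  have hK : Commute (f .b * g .b) (cartan n q (f .b) (g .c)) :=
    semiconjBy_cartan ((Commute.refl _).mul_left (hfg .b .b).symm)
      ((hfg .b .c).mul_left hg.bc)
  rw [universalR, Finset.sum_mul, Finset.mul_sum]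
  refine Finset.sum_congr rfl fun s _ => ?_
  rw [universalRTerm, smul_mul_assoc, mul_smul_comm]
  congr 1
  calc f .a ^ s * cartan n q (f .b) (g .c) * g .d ^ s * (f .b * g .b)
    _ = f .a ^ s * cartan n q (f .b) (g .c) * (f .b * (g .d ^ s * g .b)) := by
      simp only [mul_assoc, ((hfg .b .d).pow_right s).symm.left_comm]
    _ = q ^ s • (f .a ^ s * (cartan n q (f .b) (g .c) * (f .b * g .b)) * g .d ^ s) := by
      simp only [pow_mul_of_qcomm hg.db, mul_smul_comm, mul_assoc]
    _ = q ^ s • (f .a ^ s * f .b) * g .b * cartan n q (f .b) (g .c) * g .d ^ s := by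
      rw [← hK.eq]
      simp only [smul_mul_assoc, mul_assoc]
    _ = f .b * g .b * (f .a ^ s * cartan n q (f .b) (g .c) * g .d ^ s) := by
      rw [← mul_pow_of_qcomm hf.ba]
      simp only [mul_assoc, ((hfg .a .b).pow_left s).left_comm]

lemma commute_opSwap (hfg : ∀ x y, Commute (f x) (g y)) (x y : Gen) :
    Commute (opSwap g x) (opSwap f y) := by
  cases x <;> cases y <;> exact (hfg _ _).symm.op

section Intertwining

variable [NeZero n] (hq : IsPrimitiveRoot q n) (hf : Satisfies n q f) (hg : Satisfies n q g)
  (hfg : ∀ x y, Commute (f x) (g y))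
include hq hf hg hfg

lemma left_d_mul_cartan : f .d * cartan n q (f .b) (g .c) =
    cartan n q (f .b) (g .c) * (g .c * f .d) := by
  have h : SemiconjBy (f .d) (f .b) (q • f .b) := by simp [SemiconjBy, hf.db]
  rw [(semiconjBy_cartan h (hfg .d .c)).eq, cartan_smul_left hq _ hg.c_pow, mul_assoc]

lemma right_d_mul_cartan : g .d * cartan n q (f .b) (g .c) =
    cartan n q (f .b) (g .c) * (f .b * g .d) := by
  have h : SemiconjBy (g .d) (g .c) (q • g .c) := by simp [SemiconjBy, hg.dc]
  rw [(semiconjBy_cartan (hfg .b .d).symm h).eq, cartan_smul_right hq hf.b_pow (hfg .b .c),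
    mul_assoc]

lemma universalRTerm_mul_left_d (s : ℕ) : universalRTerm n q f g s * (f .d * g .c) =
    (qFact q s)⁻¹ • q ^ s • (f .a ^ s * f .d * cartan n q (f .b) (g .c) * g .d ^ s) := by
  have hd : g .d ^ s * (f .d * g .c) = q ^ s • (g .c * f .d * g .d ^ s) := by
    rw [← mul_assoc, ((hfg .d .d).pow_right s).eq.symm, mul_assoc, pow_mul_of_qcomm hg.dc,
      mul_smul_comm, ← mul_assoc, (hfg .d .c).eq]
  rw [universalRTerm, smul_mul_assoc, mul_assoc, hd, mul_smul_comm,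
    mul_assoc (f .a ^ s) (f .d), left_d_mul_cartan hq hf hg hfg]
  simp only [mul_assoc]

lemma left_d_mul_universalRTerm_zero :
    f .d * universalRTerm n q f g 0 = universalRTerm n q f g 0 * (f .d * g .c) := by
  rw [universalRTerm_mul_left_d hq hf hg hfg]
  simp [universalRTerm]

lemma left_d_mul_universalRTerm_succ {s : ℕ} (hs : s + 1 < n) :
    f .d * universalRTerm n q f g (s + 1) =
      universalRTerm n q f g (s + 1) * (f .d * g .c) + universalRDefect n q f g s := by
  rw [universalRTerm_mul_left_d hq hf hg hfg, universalRTerm, mul_smul_comm, ← mul_assoc,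
    ← mul_assoc, hf.d_mul_a_pow, universalRDefect]
  have hne := qInt_ne_zero hq s.succ_pos hs
  simp only [add_mul, smul_mul_assoc, smul_add, qFact_succ, smul_smul, mul_inv_rev]
  congr 2
  field_simp

lemma universalRTerm_mul_right_d (s : ℕ) : universalRTerm n q f g s * g .d =
    f .c * g .d * universalRTerm n q f g s + universalRDefect n q f g s := by
  have hK : Commute (f .b) (cartan n q (f .b) (g .c)) :=
    semiconjBy_cartan (Commute.refl _) (hfg .b .c)
  have hcd : f .c * g .d * (f .a ^ s * cartan n q (f .b) (g .c) * g .d ^ s) =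
      q ^ s • (f .a ^ s * (f .b * f .c) * cartan n q (f .b) (g .c) * g .d ^ (s + 1)) :=
    calc f .c * g .d * (f .a ^ s * cartan n q (f .b) (g .c) * g .d ^ s)
      _ = f .c * f .a ^ s * (g .d * cartan n q (f .b) (g .c)) * g .d ^ s := by
        simp only [mul_assoc, ((hfg .a .d).pow_left s).symm.left_comm]
      _ = q ^ s • (f .a ^ s * f .c * (f .b * cartan n q (f .b) (g .c)) * g .d ^ (s + 1)) := by
        rw [right_d_mul_cartan hq hf hg hfg, mul_pow_of_qcomm hf.ca, hK.eq, pow_succ']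
        simp only [smul_mul_assoc, mul_assoc]
      _ = q ^ s • (f .a ^ s * (f .b * f .c) * cartan n q (f .b) (g .c) * g .d ^ (s + 1)) := by
        rw [hf.bc]
        simp only [mul_assoc]
  rw [universalRTerm, mul_smul_comm, hcd, universalRDefect, smul_mul_assoc, mul_assoc, ← pow_succ,
    ← smul_add]
  simp only [mul_sub, sub_mul, mul_one, mul_smul_comm, smul_mul_assoc, add_sub_cancel]

lemma universalR_mul_d : universalR n q f g * (f .d * g .c + g .d) =
    (f .c * g .d + f .d) * universalR n q f g := by
  obtain ⟨N, rfl⟩ : ∃ N, n = N + 1 := Nat.exists_eq_succ_of_ne_zero (NeZero.ne n)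
  have last : universalRDefect (N + 1) q f g N = 0 := by simp [universalRDefect, hg.d_pow]
  have left : f .d * universalR (N + 1) q f g = universalR (N + 1) q f g * (f .d * g .c) +
      ∑ s ∈ Finset.range N, universalRDefect (N + 1) q f g s := by
    simp only [universalR, Finset.sum_range_succ', mul_add, add_mul, Finset.mul_sum,
      Finset.sum_mul, left_d_mul_universalRTerm_zero hq hf hg hfg]
    rw [Finset.sum_congr rfl fun s hs => left_d_mul_universalRTerm_succ hq hf hg hfg
      (Nat.succ_lt_succ (Finset.mem_range.mp hs)), Finset.sum_add_distrib]
    abel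
  have right : universalR (N + 1) q f g * g .d = f .c * g .d * universalR (N + 1) q f g +
      ∑ s ∈ Finset.range N, universalRDefect (N + 1) q f g s := by
    rw [← add_zero (∑ s ∈ _, _), ← last, ← Finset.sum_range_succ, universalR, Finset.sum_mul,
      Finset.mul_sum, ← Finset.sum_add_distrib]
    exact Finset.sum_congr rfl fun s _ => universalRTerm_mul_right_d hq hf hg hfg s
  rw [mul_add, right, add_mul, left]
  abel

lemma universalR_mul_a : universalR n q f g * (f .a * g .b + g .a) =
    (f .b * g .a + f .a) * universalR n q f g := by
  have h := universalR_mul_d hq hg.opSwap hf.opSwap (commute_opSwap hfg)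
  rw [universalR_opSwap (hfg .b .c)] at h
  simp only [opSwap, ← MulOpposite.op_mul, ← MulOpposite.op_add] at h
  exact (MulOpposite.op_injective h).symm

end Intertwining

lemma universalR_mul_c (hf : Satisfies n q f) (hg : Satisfies n q g)
    (hfg : ∀ x y, Commute (f x) (g y)) :
    universalR n q f g * (f .c * g .c) = f .c * g .c * universalR n q f g := by
  have h := universalR_mul_b hg.opSwap hf.opSwap (commute_opSwap hfg)
  rw [universalR_opSwap (hfg .b .c)] at h
  simp only [opSwap, ← MulOpposite.op_mul] at h
  exact (MulOpposite.op_injective h).symm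

end UniversalR

section QuasiCocommutativity

variable {k : Type*} [Field k] {n : ℕ} {q : k}

/-- The generators in the first factor of `D_n ⊗ D_n`. -/
def genLeft (n : ℕ) (q : k) (x : Gen) : D n q ⊗[k] D n q := D.of n q x ⊗ₜ 1

/-- The generators in the second factor of `D_n ⊗ D_n`. -/
def genRight (n : ℕ) (q : k) (x : Gen) : D n q ⊗[k] D n q := 1 ⊗ₜ D.of n q x

lemma genLeft_satisfies (n : ℕ) (q : k) : Satisfies n q (genLeft n q) :=
  (D.satisfies n q).map (N := D n q ⊗[k] D n q) Algebra.TensorProduct.includeLeft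

lemma genRight_satisfies (n : ℕ) (q : k) : Satisfies n q (genRight n q) :=
  (D.satisfies n q).map (N := D n q ⊗[k] D n q) Algebra.TensorProduct.includeRight

lemma commute_genLeft_genRight (x y : Gen) : Commute (genLeft n q x) (genRight n q y) := by
  simp [Commute, SemiconjBy, genLeft, genRight]

lemma rMatrix_eq_universalR (n : ℕ) (q : k) :
    rMatrix n q = universalR n q (genLeft n q) (genRight n q) := by
  simp only [rMatrix, universalR, universalRTerm, cartan, mul_smul_comm, smul_mul_assoc,
    Finset.mul_sum, Finset.sum_mul, Finset.smul_sum]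
  rw [Finset.sum_comm]
  refine Finset.sum_congr rfl fun s _ => Finset.sum_congr rfl fun m _ =>
    Finset.sum_congr rfl fun t _ => ?_
  simp only [genLeft, genRight, Algebra.TensorProduct.tmul_pow, one_pow,
    Algebra.TensorProduct.tmul_mul_tmul, one_mul, mul_one, smul_smul]
  congr 1
  rw [zpow_neg, ← Nat.cast_mul, zpow_natCast, ← inv_pow]
  ring

lemma D.induction {p : D n q → Prop} (of : ∀ x, p (D.of n q x))
    (algebraMap : ∀ t : k, p (algebraMap k (D n q) t)) (add : ∀ x y, p x → p y → p (x + y))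
    (mul : ∀ x y, p x → p y → p (x * y)) (x : D n q) : p x := by
  obtain ⟨x, rfl⟩ := RingQuot.mkAlgHom_surjective k (Rel n q) x
  induction x using FreeAlgebra.induction with
  | grade0 t => simpa using algebraMap t
  | grade1 x => exact of x
  | mul x y hx hy => simpa using mul _ _ hx hy
  | add x y hx hy => simpa using add _ _ hx hy

lemma rMatrix_mul_comul [NeZero n] (hq : IsPrimitiveRoot q n) (x : D n q) :
    rMatrix n q * comul hq x = Algebra.TensorProduct.comm k _ _ (comul hq x) * rMatrix n q := by
  rw [rMatrix_eq_universalR]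
  induction x using D.induction with
  | of x =>
    have hl := genLeft_satisfies n q
    have hr := genRight_satisfies n q
    cases x
    · simpa [comul, comulGen, genLeft, genRight] using
        universalR_mul_a hq hl hr commute_genLeft_genRight
    · simpa [comul, comulGen, genLeft, genRight] using
        universalR_mul_b hl hr commute_genLeft_genRight
    · simpa [comul, comulGen, genLeft, genRight] using
        universalR_mul_c hl hr commute_genLeft_genRight
    · simpa [comul, comulGen, genLeft, genRight] using
        universalR_mul_d hq hl hr commute_genLeft_genRight
  | algebraMap t => rw [AlgHom.commutes, AlgEquiv.commutes, Algebra.commutes]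
  | add x y hx hy => simp only [map_add, mul_add, add_mul, hx, hy]
  | mul x y hx hy => simp only [map_mul]; rw [← mul_assoc, hx, mul_assoc, hy, mul_assoc]

lemma outerAction_tmul {V W : Type*} [AddCommGroup V] [Module k V] [AddCommGroup W] [Module k W]
    (ρ : D n q →ₐ[k] Module.End k V) (τ : D n q →ₐ[k] Module.End k W) (x y : D n q) :
    outerAction ρ τ (x ⊗ₜ y) = TensorProduct.map (ρ x) (τ y) := rfl

lemma outerAction_rMatrix {V W : Type*} [AddCommGroup V] [Module k V] [AddCommGroup W] [Module k W]
    (ρ : D n q →ₐ[k] Module.End k V) (τ : D n q →ₐ[k] Module.End k W) :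
    outerAction ρ τ (rMatrix n q) =
      universalR n q (fun x => TensorProduct.map (ρ (D.of n q x)) 1)
        (fun x => TensorProduct.map 1 (τ (D.of n q x))) := by
  have h := map_universalR (n := n) (q := q) (outerAction ρ τ) (genLeft n q) (genRight n q)
  simpa only [← rMatrix_eq_universalR, genLeft, genRight, outerAction_tmul, map_one] using h

lemma comm_outerAction_apply {V : Type*} [AddCommGroup V] [Module k V]
    (ρ : D n q →ₐ[k] Module.End k V) (x : D n q ⊗[k] D n q) (z : V ⊗[k] V) :
    TensorProduct.comm k V V (outerAction ρ ρ (Algebra.TensorProduct.comm k _ _ x) z) =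
      outerAction ρ ρ x (TensorProduct.comm k V V z) := by
  induction x with
  | zero => simp
  | add x y hx hy => simp [hx, hy]
  | tmul x y =>
    induction z with
    | zero => simp
    | add z w hz hw => simp only [map_add, hz, hw]
    | tmul v w => simp [outerAction_tmul]

theorem rCheck_mul_tensorModule [NeZero n] (hq : IsPrimitiveRoot q n) {V : Type*}
    [AddCommGroup V] [Module k V] (ρ : D n q →ₐ[k] Module.End k V) (x : D n q) :
    rCheck ρ * tensorModule hq ρ ρ x = tensorModule hq ρ ρ x * rCheck ρ := by
  refine LinearMap.ext fun z => ?_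
  calc TensorProduct.comm k V V (outerAction ρ ρ (rMatrix n q) (tensorModule hq ρ ρ x z))
    _ = TensorProduct.comm k V V (outerAction ρ ρ (rMatrix n q * comul hq x) z) := by
      rw [map_mul]; rfl
    _ = tensorModule hq ρ ρ x (rCheck ρ z) := by
      rw [rMatrix_mul_comul, map_mul, Module.End.mul_apply, comm_outerAction_apply]
      rfl

end QuasiCocommutativity

section StandardVectors

variable {k : Type*} [Field k] {n : ℕ} {q : k} {ℓ : ℕ}

/-- The standard basis vectors of `k^ℓ`, extended by zero to all indices. -/
noncomputable def stdVec (k : Type*) [Field k] (ℓ j : ℕ) : Fin ℓ → k :=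
  if h : j < ℓ then Pi.basisFun k (Fin ℓ) ⟨j, h⟩ else 0

lemma stdVec_of_lt {j : ℕ} (h : j < ℓ) : stdVec k ℓ j = Pi.basisFun k (Fin ℓ) ⟨j, h⟩ :=
  dif_pos h

lemma stdVec_of_le {j : ℕ} (h : ℓ ≤ j) : stdVec k ℓ j = 0 := dif_neg h.not_gt

lemma stdVec_ext {X : Type*} [AddCommGroup X] [Module k X] {S T : (Fin ℓ → k) →ₗ[k] X}
    (h : ∀ j < ℓ, S (stdVec k ℓ j) = T (stdVec k ℓ j)) : S = T :=
  (Pi.basisFun k (Fin ℓ)).ext fun j => by rw [← stdVec_of_lt j.isLt]; exact h j j.isLt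

/-- The coordinate functionals on `k^ℓ`, extended by zero to all indices. -/
def coord (k : Type*) [Field k] (ℓ p : ℕ) : (Fin ℓ → k) →ₗ[k] k :=
  if h : p < ℓ then LinearMap.proj ⟨p, h⟩ else 0

lemma coord_fin (p : Fin ℓ) (v : Fin ℓ → k) : coord k ℓ p v = v p := by simp [coord]

lemma coord_of_le {p : ℕ} (h : ℓ ≤ p) : coord k ℓ p = 0 := dif_neg h.not_gt

lemma coord_stdVec {p j : ℕ} (hj : j < ℓ) :
    coord k ℓ p (stdVec k ℓ j) = if p = j then 1 else 0 := by
  rcases lt_or_ge p ℓ with hp | hp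
  · simp [coord, hp, stdVec_of_lt hj, Pi.single_apply]
  · rw [coord_of_le hp, LinearMap.zero_apply, if_neg (by omega)]

lemma sum_coord_smul_stdVec (v : Fin ℓ → k) :
    ∑ p : Fin ℓ, coord k ℓ p v • stdVec k ℓ p = v := by
  conv_rhs => rw [← (Pi.basisFun k (Fin ℓ)).sum_repr v]
  exact Finset.sum_congr rfl fun p _ => by
    rw [coord_fin, stdVec_of_lt p.isLt, Pi.basisFun_repr]

lemma eq_smul_stdVec {v : Fin ℓ → k} {N : ℕ} (h : ∀ p < ℓ, p ≠ N → coord k ℓ p v = 0) :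
    v = coord k ℓ N v • stdVec k ℓ N := by
  rcases lt_or_ge N ℓ with hN | hN
  · conv_lhs => rw [← sum_coord_smul_stdVec v]
    refine Finset.sum_eq_single (⟨N, hN⟩ : Fin ℓ) (fun p _ hp => ?_) (by simp)
    rw [h p p.isLt fun e => hp (Fin.ext e), zero_smul]
  · rw [stdVec_of_le hN, smul_zero, ← sum_coord_smul_stdVec v]
    exact Finset.sum_eq_zero fun p _ => by rw [h p p.isLt (by omega), zero_smul]

lemma zpow_eq_of_dvd_sub [NeZero n] (hq : IsPrimitiveRoot q n) {x y : ℤ}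
    (h : (n : ℤ) ∣ x - y) : q ^ x = q ^ y := by
  rw [← sub_add_cancel x y, zpow_add₀ (hq.ne_zero (NeZero.ne n)),
    (hq.zpow_eq_one_iff_dvd _).mpr h, one_mul]

lemma alpha_ne_zero (hq : IsPrimitiveRoot q n) {i : ℕ} (h0 : 0 < i) (hi : i < ℓ) (hℓ : ℓ ≤ n) :
    alpha q i ℓ ≠ 0 := by
  refine div_ne_zero (mul_ne_zero ?_ ?_) (sub_ne_zero.mpr (hq.ne_one (by omega)))
  · exact sub_ne_zero.mpr (hq.pow_ne_one_of_pos_of_lt h0.ne' (by omega))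
  · refine sub_ne_zero.mpr fun h => ?_
    have hdvd := (hq.zpow_eq_one_iff_dvd _).mp h.symm
    have := Int.eq_zero_of_abs_lt_dvd hdvd (by rw [abs_lt]; omega)
    omega

section Action

variable (hn : 2 ≤ n) (hq : IsPrimitiveRoot q n) (hℓ : ℓ ≤ n) (s : ZMod n) (j : ℕ)

lemma simpleModule_of (x : Gen) : simpleModule hn hq hℓ s (D.of n q x) = simpleGen q ℓ s x :=
  D.lift_of _ _ _

lemma simpleModule_a_stdVec :
    simpleModule hn hq hℓ s (D.of n q .a) (stdVec k ℓ j) = stdVec k ℓ (j + 1) := by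
  rw [simpleModule_of]
  rcases lt_or_ge j ℓ with h | h
  · rw [stdVec_of_lt h, simpleGen_a]; rfl
  · rw [stdVec_of_le h, stdVec_of_le (by omega), map_zero]

lemma simpleModule_b_stdVec : simpleModule hn hq hℓ s (D.of n q .b) (stdVec k ℓ j) =
    q ^ ((s.val : ℤ) + j) • stdVec k ℓ j := by
  rw [simpleModule_of]
  rcases lt_or_ge j ℓ with h | h
  · rw [stdVec_of_lt h, simpleGen_b]
  · rw [stdVec_of_le h, map_zero, smul_zero]

lemma simpleModule_c_stdVec : simpleModule hn hq hℓ s (D.of n q .c) (stdVec k ℓ j) =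
    q ^ ((j : ℤ) + 1 - (s.val + ℓ)) • stdVec k ℓ j := by
  rw [simpleModule_of]
  rcases lt_or_ge j ℓ with h | h
  · rw [stdVec_of_lt h, simpleGen_c]
  · rw [stdVec_of_le h, map_zero, smul_zero]

lemma simpleModule_d_stdVec : simpleModule hn hq hℓ s (D.of n q .d) (stdVec k ℓ j) =
    alpha q j ℓ • stdVec k ℓ (j - 1) := by
  rw [simpleModule_of]
  rcases lt_trichotomy j ℓ with h | rfl | h
  · rw [stdVec_of_lt h, simpleGen_d]
    rcases Nat.eq_zero_or_pos j with rfl | h0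
    · simp [alpha_zero]
    · rw [stdVec_of_lt (show j - 1 < ℓ by omega)]
      exact if_pos h0
  · rw [alpha_self, stdVec_of_le le_rfl, map_zero, zero_smul]
  · rw [stdVec_of_le h.le, stdVec_of_le (by omega), map_zero, smul_zero]

lemma coord_zero_comp_a : coord k ℓ 0 ∘ₗ simpleModule hn hq hℓ s (D.of n q .a) = 0 := by
  refine stdVec_ext fun j _ => ?_
  rw [LinearMap.comp_apply, simpleModule_a_stdVec, LinearMap.zero_apply]
  rcases lt_or_ge (j + 1) ℓ with h | h
  · simp [coord_stdVec h]
  · rw [stdVec_of_le h, map_zero]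

lemma coord_comp_b (p : ℕ) : coord k ℓ p ∘ₗ simpleModule hn hq hℓ s (D.of n q .b) =
    q ^ ((s.val : ℤ) + p) • coord k ℓ p := by
  refine stdVec_ext fun j hj => ?_
  simp only [LinearMap.comp_apply, LinearMap.smul_apply, simpleModule_b_stdVec, map_smul,
    coord_stdVec hj]
  split_ifs with h <;> simp [h]

lemma coord_comp_c (p : ℕ) : coord k ℓ p ∘ₗ simpleModule hn hq hℓ s (D.of n q .c) =
    q ^ ((p : ℤ) + 1 - (s.val + ℓ)) • coord k ℓ p := by
  refine stdVec_ext fun j hj => ?_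
  simp only [LinearMap.comp_apply, LinearMap.smul_apply, simpleModule_c_stdVec, map_smul,
    coord_stdVec hj]
  split_ifs with h <;> simp [h]

lemma coord_comp_d (p : ℕ) : coord k ℓ p ∘ₗ simpleModule hn hq hℓ s (D.of n q .d) =
    alpha q (p + 1) ℓ • coord k ℓ (p + 1) := by
  refine stdVec_ext fun j hj => ?_
  simp only [LinearMap.comp_apply, LinearMap.smul_apply, simpleModule_d_stdVec, map_smul,
    coord_stdVec hj, coord_stdVec (show j - 1 < ℓ by omega)]
  rcases j with _ | j
  · simp [alpha_zero]
  · by_cases h : p = j <;> simp [h]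

variable {s}

lemma eq_smul_stdVec_zero_of_d_eq_zero {v : Fin ℓ → k}
    (hv : simpleModule hn hq hℓ s (D.of n q .d) v = 0) :
    v = coord k ℓ 0 v • stdVec k ℓ 0 := by
  refine eq_smul_stdVec fun p hp h0 => ?_
  obtain ⟨p, rfl⟩ := Nat.exists_eq_succ_of_ne_zero h0
  have h := LinearMap.congr_fun (coord_comp_d hn hq hℓ s p) v
  rw [LinearMap.comp_apply, hv, map_zero, LinearMap.smul_apply, eq_comm, smul_eq_zero] at h
  exact h.resolve_left (alpha_ne_zero hq p.succ_pos hp hℓ)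

lemma eq_smul_stdVec_of_b_eq_smul {v : Fin ℓ → k} {N : ℕ} (hN : N < n)
    (hv : simpleModule hn hq hℓ s (D.of n q .b) v = q ^ ((s.val : ℤ) + N) • v) :
    v = coord k ℓ N v • stdVec k ℓ N := by
  have h0 : q ≠ 0 := hq.ne_zero (by omega)
  refine eq_smul_stdVec fun p hp hpN => ?_
  have h := LinearMap.congr_fun (coord_comp_b hn hq hℓ s p) v
  rw [LinearMap.comp_apply, hv, map_smul, LinearMap.smul_apply, zpow_add₀ h0, zpow_add₀ h0,
    mul_smul, mul_smul, smul_right_inj (zpow_ne_zero _ h0), zpow_natCast, zpow_natCast,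
    ← sub_eq_zero, ← sub_smul, smul_eq_zero, sub_eq_zero] at h
  exact h.resolve_left fun e => hpN (hq.pow_inj hN (by omega) e).symm

end Action

end StandardVectors

section Rows

variable {k : Type*} [Field k] {n : ℕ} {q : k} {ℓ : ℕ}
  {W : Type*} [AddCommGroup W] [Module k W]

/-- The vector `w_p` in `y = ∑_p e_p ⊗ w_p`, for `y` in `k^ℓ ⊗ W`. -/
def row (k : Type*) [Field k] (ℓ : ℕ) (W : Type*) [AddCommGroup W] [Module k W] (p : ℕ) :
    (Fin ℓ → k) ⊗[k] W →ₗ[k] W :=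
  (TensorProduct.lid k W).toLinearMap ∘ₗ (coord k ℓ p).rTensor W

@[simp] lemma row_tmul (p : ℕ) (v : Fin ℓ → k) (w : W) :
    row k ℓ W p (v ⊗ₜ w) = coord k ℓ p v • w := by
  simp [row]

lemma sum_stdVec_tmul_row (y : (Fin ℓ → k) ⊗[k] W) :
    ∑ p : Fin ℓ, stdVec k ℓ p ⊗ₜ row k ℓ W p y = y := by
  induction y with
  | zero => simp
  | add y z hy hz => simp only [map_add, TensorProduct.tmul_add, Finset.sum_add_distrib, hy, hz]
  | tmul v w =>
    simp only [row_tmul, TensorProduct.tmul_smul, TensorProduct.smul_tmul',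
      ← TensorProduct.sum_tmul, sum_coord_smul_stdVec]

lemma eq_zero_of_row_eq_zero {y : (Fin ℓ → k) ⊗[k] W} (h : ∀ p < ℓ, row k ℓ W p y = 0) :
    y = 0 := by
  rw [← sum_stdVec_tmul_row y]
  exact Finset.sum_eq_zero fun p _ => by rw [h p p.isLt, TensorProduct.tmul_zero]

lemma row_map {p p' : ℕ} {t : k} {S : Module.End k (Fin ℓ → k)}
    (hS : coord k ℓ p ∘ₗ S = t • coord k ℓ p') (T : Module.End k W) (y : (Fin ℓ → k) ⊗[k] W) :
    row k ℓ W p (TensorProduct.map S T y) = t • T (row k ℓ W p' y) := by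
  induction y with
  | zero => simp
  | add y z hy hz => simp only [map_add, smul_add, hy, hz]
  | tmul v w =>
    rw [TensorProduct.map_tmul, row_tmul, row_tmul, ← LinearMap.comp_apply, hS,
      LinearMap.smul_apply, map_smul, smul_assoc]

lemma row_map_one (p : ℕ) (T : Module.End k W) (y : (Fin ℓ → k) ⊗[k] W) :
    row k ℓ W p (TensorProduct.map 1 T y) = T (row k ℓ W p y) := by
  rw [row_map (t := 1) (p' := p) (by rw [one_smul]; rfl), one_smul]

variable [NeZero n] {V : Type*} [AddCommGroup V] [Module k V] (hq : IsPrimitiveRoot q n)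

lemma tensorModule_b (ρ : D n q →ₐ[k] Module.End k V) (τ : D n q →ₐ[k] Module.End k W) :
    tensorModule hq ρ τ (D.of n q .b) =
      TensorProduct.map (ρ (D.of n q .b)) (τ (D.of n q .b)) := by
  simp [tensorModule, comul, comulGen, outerAction_tmul]

lemma tensorModule_c (ρ : D n q →ₐ[k] Module.End k V) (τ : D n q →ₐ[k] Module.End k W) :
    tensorModule hq ρ τ (D.of n q .c) =
      TensorProduct.map (ρ (D.of n q .c)) (τ (D.of n q .c)) := by
  simp [tensorModule, comul, comulGen, outerAction_tmul]

lemma tensorModule_d (ρ : D n q →ₐ[k] Module.End k V) (τ : D n q →ₐ[k] Module.End k W) :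
    tensorModule hq ρ τ (D.of n q .d) =
      TensorProduct.map (ρ (D.of n q .d)) (τ (D.of n q .c)) +
        TensorProduct.map 1 (τ (D.of n q .d)) := by
  simp [tensorModule, comul, comulGen, outerAction_tmul]

lemma c_injective (τ : D n q →ₐ[k] Module.End k W) :
    Function.Injective (τ (D.of n q .c)) :=
  ((Module.End.isUnit_iff _).mp
    (IsUnit.of_pow_eq_one ((D.satisfies n q).map τ).c_pow (NeZero.ne n))).injective

variable (hn : 2 ≤ n) (hℓ : ℓ ≤ n) (s : ZMod n) (τ : D n q →ₐ[k] Module.End k W) (p : ℕ)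
  (y : (Fin ℓ → k) ⊗[k] W)

lemma row_b : row k ℓ W p (tensorModule hq (simpleModule hn hq hℓ s) τ (D.of n q .b) y) =
    q ^ ((s.val : ℤ) + p) • τ (D.of n q .b) (row k ℓ W p y) := by
  rw [tensorModule_b, row_map (coord_comp_b hn hq hℓ s p)]

lemma row_c : row k ℓ W p (tensorModule hq (simpleModule hn hq hℓ s) τ (D.of n q .c) y) =
    q ^ ((p : ℤ) + 1 - (s.val + ℓ)) • τ (D.of n q .c) (row k ℓ W p y) := by
  rw [tensorModule_c, row_map (coord_comp_c hn hq hℓ s p)]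

lemma row_d : row k ℓ W p (tensorModule hq (simpleModule hn hq hℓ s) τ (D.of n q .d) y) =
    alpha q (p + 1) ℓ • τ (D.of n q .c) (row k ℓ W (p + 1) y) +
      τ (D.of n q .d) (row k ℓ W p y) := by
  rw [tensorModule_d, LinearMap.add_apply, map_add, row_map (coord_comp_d hn hq hℓ s p),
    row_map_one]

variable {s τ y}

lemma eq_of_row_zero_eq {z : (Fin ℓ → k) ⊗[k] W}
    (hy : tensorModule hq (simpleModule hn hq hℓ s) τ (D.of n q .d) y = 0)
    (hz : tensorModule hq (simpleModule hn hq hℓ s) τ (D.of n q .d) z = 0)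
    (h : row k ℓ W 0 y = row k ℓ W 0 z) : y = z := by
  have hd : tensorModule hq (simpleModule hn hq hℓ s) τ (D.of n q .d) (y - z) = 0 := by
    rw [map_sub, hy, hz, sub_zero]
  refine sub_eq_zero.mp (eq_zero_of_row_eq_zero fun p => ?_)
  induction p with
  | zero => exact fun _ => by rw [map_sub, h, sub_self]
  | succ p ih =>
    intro hp
    have hrow := row_d hq hn hℓ s τ p (y - z)
    rw [hd, ih (by omega), map_zero, map_zero, add_zero, eq_comm, smul_eq_zero] at hrow
    exact (map_eq_zero_iff _ (c_injective τ)).mp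
      (hrow.resolve_left (alpha_ne_zero hq p.succ_pos hp hℓ))

end Rows

section LowestVectors

variable {k : Type*} [Field k] {n : ℕ} {q : k} {ℓ i : ℕ}

/-- The coefficient of `e_p ⊗ e_{i-p}` in `lowestVec q ℓ r i`. It is zero for `p > i`, as
`α_0(ℓ) = 0`. -/
noncomputable def lowestCoeff {n : ℕ} (q : k) (ℓ : ℕ) (r : ZMod n) (i p : ℕ) : k :=
  ∏ j ∈ Finset.range p,
    -(alpha q (i - j) ℓ / alpha q (j + 1) ℓ * q ^ ((r.val : ℤ) + ℓ + j - i))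

/-- The vector of lowest weight, annihilated by `d`, that generates the summand
`V(2ℓ-1-2i, 2r+i)` of `V(ℓ,r) ⊗ V(ℓ,r)`. -/
noncomputable def lowestVec {n : ℕ} (q : k) (ℓ : ℕ) (r : ZMod n) (i : ℕ) :
    (Fin ℓ → k) ⊗[k] (Fin ℓ → k) :=
  ∑ p ∈ Finset.range ℓ, lowestCoeff q ℓ r i p • (stdVec k ℓ p ⊗ₜ stdVec k ℓ (i - p))

lemma lowestCoeff_succ (r : ZMod n) (i p : ℕ) : lowestCoeff q ℓ r i (p + 1) =
    lowestCoeff q ℓ r i p *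
      -(alpha q (i - p) ℓ / alpha q (p + 1) ℓ * q ^ ((r.val : ℤ) + ℓ + p - i)) :=
  Finset.prod_range_succ _ _

lemma lowestCoeff_eq_zero (r : ZMod n) {p : ℕ} (hp : i < p) : lowestCoeff q ℓ r i p = 0 :=
  Finset.prod_eq_zero (Finset.mem_range.mpr hp) (by simp [alpha_zero])

lemma row_lowestVec (r : ZMod n) (hi : i < ℓ) (p : ℕ) :
    row k ℓ _ p (lowestVec q ℓ r i) = lowestCoeff q ℓ r i p • stdVec k ℓ (i - p) := by
  have hterm : ∀ j ∈ Finset.range ℓ, row k ℓ _ p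
      (lowestCoeff q ℓ r i j • (stdVec k ℓ j ⊗ₜ stdVec k ℓ (i - j))) =
        if p = j then lowestCoeff q ℓ r i p • stdVec k ℓ (i - p) else 0 := by
    intro j hj
    rw [map_smul, row_tmul, coord_stdVec (Finset.mem_range.mp hj)]
    split_ifs with h <;> simp [h]
  rw [lowestVec, map_sum, Finset.sum_congr rfl hterm, Finset.sum_ite_eq]
  split_ifs with h
  · rfl
  · rw [lowestCoeff_eq_zero r (by simp only [Finset.mem_range] at h; omega), zero_smul]

lemma row_zero_lowestVec (r : ZMod n) (hi : i < ℓ) :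
    row k ℓ _ 0 (lowestVec q ℓ r i) = stdVec k ℓ i := by
  simp [row_lowestVec r hi, lowestCoeff]

section Square

variable [NeZero n] (hn : 2 ≤ n) (hq : IsPrimitiveRoot q n) (hℓ : ℓ ≤ n) (r : ZMod n)

/-- The `D_n`-module `V(ℓ,r) ⊗ V(ℓ,r)`. -/
noncomputable abbrev squareModule :
    D n q →ₐ[k] Module.End k ((Fin ℓ → k) ⊗[k] (Fin ℓ → k)) :=
  tensorModule hq (simpleModule hn hq hℓ r) (simpleModule hn hq hℓ r)

lemma squareModule_d_lowestVec (hi : i < ℓ) :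
    squareModule hn hq hℓ r (D.of n q .d) (lowestVec q ℓ r i) = 0 := by
  have h0 : q ≠ 0 := hq.ne_zero (NeZero.ne n)
  refine eq_zero_of_row_eq_zero fun p hp => ?_
  rw [row_d, row_lowestVec r hi, row_lowestVec r hi, map_smul, map_smul, simpleModule_c_stdVec,
    simpleModule_d_stdVec, Nat.sub_sub]
  rcases lt_or_ge p i with hpi | hpi
  · have hα : alpha q (p + 1) ℓ ≠ 0 := alpha_ne_zero hq p.succ_pos (by omega) hℓ
    have hexp : q ^ ((r.val : ℤ) + ℓ + p - i) *
        q ^ (((i - (p + 1) : ℕ) : ℤ) + 1 - (r.val + ℓ)) = 1 := by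
      rw [← zpow_add₀ h0, ← zpow_zero q]
      congr 1
      omega
    rw [smul_smul, smul_smul, smul_smul, ← add_smul, lowestCoeff_succ, smul_eq_zero]
    left
    field_simp
    linear_combination -(lowestCoeff q ℓ r i p * alpha q (i - p) ℓ) * hexp
  · rw [lowestCoeff_eq_zero r (by omega), Nat.sub_eq_zero_of_le hpi, alpha_zero]
    simp

variable {r} in
lemma squareModule_d_eq_zero_of_semiconj {x : Gen} {t : k}
    (hx : D.of n q .d * D.of n q x = t • (D.of n q x * D.of n q .d))
    {y : (Fin ℓ → k) ⊗[k] (Fin ℓ → k)} (hy : squareModule hn hq hℓ r (D.of n q .d) y = 0) :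
    squareModule hn hq hℓ r (D.of n q .d) (squareModule hn hq hℓ r (D.of n q x) y) = 0 := by
  rw [← Module.End.mul_apply, ← map_mul, hx, map_smul, map_mul, LinearMap.smul_apply,
    Module.End.mul_apply, hy, map_zero, smul_zero]

lemma squareModule_b_lowestVec (hi : i < ℓ) :
    squareModule hn hq hℓ r (D.of n q .b) (lowestVec q ℓ r i) =
      q ^ (2 * (r.val : ℤ) + i) • lowestVec q ℓ r i := by
  have hd := squareModule_d_lowestVec hn hq hℓ r hi
  refine eq_of_row_zero_eq hq hn hℓ
    (squareModule_d_eq_zero_of_semiconj hn hq hℓ (D.satisfies n q).db hd)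
    (by rw [map_smul, hd, smul_zero]) ?_
  rw [row_b, map_smul, row_zero_lowestVec r hi, simpleModule_b_stdVec, smul_smul,
    ← zpow_add₀ (hq.ne_zero (NeZero.ne n))]
  congr 2
  push_cast
  ring

lemma squareModule_c_lowestVec (hi : i < ℓ) :
    squareModule hn hq hℓ r (D.of n q .c) (lowestVec q ℓ r i) =
      q ^ ((i : ℤ) + 2 - 2 * (r.val + ℓ)) • lowestVec q ℓ r i := by
  have hd := squareModule_d_lowestVec hn hq hℓ r hi
  refine eq_of_row_zero_eq hq hn hℓ
    (squareModule_d_eq_zero_of_semiconj hn hq hℓ (D.satisfies n q).dc hd)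
    (by rw [map_smul, hd, smul_zero]) ?_
  rw [row_c, map_smul, row_zero_lowestVec r hi, simpleModule_c_stdVec, smul_smul,
    ← zpow_add₀ (hq.ne_zero (NeZero.ne n))]
  congr 2
  push_cast
  ring

variable {r}

lemma row_zero_eq_smul_stdVec {y : (Fin ℓ → k) ⊗[k] (Fin ℓ → k)} {N : ℕ} (hN : N < n)
    (hb : squareModule hn hq hℓ r (D.of n q .b) y = q ^ (2 * (r.val : ℤ) + N) • y) :
    row k ℓ _ 0 y = coord k ℓ N (row k ℓ _ 0 y) • stdVec k ℓ N := by
  have h0 : q ≠ 0 := hq.ne_zero (NeZero.ne n)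
  refine eq_smul_stdVec_of_b_eq_smul hn hq hℓ (s := r) hN ?_
  have h := congrArg (row k ℓ _ 0) hb
  rw [row_b, map_smul, Nat.cast_zero, add_zero, two_mul, add_assoc, zpow_add₀ h0, mul_smul] at h
  exact smul_right_injective _ (zpow_ne_zero _ h0) h

lemma exists_eq_smul_lowestVec (hi : i < ℓ) {y : (Fin ℓ → k) ⊗[k] (Fin ℓ → k)}
    (hd : squareModule hn hq hℓ r (D.of n q .d) y = 0)
    (hb : squareModule hn hq hℓ r (D.of n q .b) y = q ^ (2 * (r.val : ℤ) + i) • y) :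
    ∃ t : k, y = t • lowestVec q ℓ r i := by
  refine ⟨coord k ℓ i (row k ℓ _ 0 y), eq_of_row_zero_eq hq hn hℓ hd ?_ ?_⟩
  · rw [map_smul, squareModule_d_lowestVec hn hq hℓ r hi, smul_zero]
  · rw [map_smul, row_zero_lowestVec r hi]
    exact row_zero_eq_smul_stdVec hn hq hℓ (by omega) hb

lemma eq_zero_of_weight_ge {y : (Fin ℓ → k) ⊗[k] (Fin ℓ → k)} {N : ℕ} (hℓN : ℓ ≤ N) (hN : N < n)
    (hd : squareModule hn hq hℓ r (D.of n q .d) y = 0)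
    (hb : squareModule hn hq hℓ r (D.of n q .b) y = q ^ (2 * (r.val : ℤ) + N) • y) :
    y = 0 := by
  refine eq_of_row_zero_eq hq hn hℓ hd (map_zero _) ?_
  rw [row_zero_eq_smul_stdVec hn hq hℓ hN hb, stdVec_of_le hℓN, smul_zero, map_zero]

end Square

section Eigenvalue

variable {E : Type*} [AddCommGroup E] [Module k E] {φ : E →ₗ[k] k}

lemma apply_pow_eq_mul {T : Module.End k E} {t : k} (h : ∀ v, φ (T v) = t * φ v) (j : ℕ) (v : E) :
    φ ((T ^ j) v) = t ^ j * φ v := by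
  induction j generalizing v with
  | zero => simp
  | succ j ih => rw [pow_succ, Module.End.mul_apply, ih, h, pow_succ, mul_assoc]

lemma apply_cartan {S T : Module.End k E} {x y : k} (hS : ∀ v, φ (S v) = x * φ v)
    (hT : ∀ v, φ (T v) = y * φ v) (v : E) :
    φ (cartan n q S T v) = cartan n q x y * φ v := by
  simp only [cartan, LinearMap.smul_apply, LinearMap.sum_apply, Module.End.mul_apply, map_smul,
    map_sum, apply_pow_eq_mul hS, apply_pow_eq_mul hT, Finset.sum_mul, smul_mul_assoc, mul_assoc]

lemma apply_universalR [NeZero n] {f g : Gen → Module.End k E} {x y : k}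
    (ha : ∀ v, φ (f .a v) = 0) (hb : ∀ v, φ (f .b v) = x * φ v)
    (hc : ∀ v, φ (g .c v) = y * φ v) (v : E) :
    φ (universalR n q f g v) = cartan n q x y * φ v := by
  rw [universalR, LinearMap.sum_apply, map_sum,
    Finset.sum_eq_single_of_mem 0 (Finset.mem_range.mpr (NeZero.pos n)) fun s _ hs => ?_]
  · simp [universalRTerm, qFact, apply_cartan hb hc]
  · obtain ⟨s, rfl⟩ := Nat.exists_eq_succ_of_ne_zero hs
    simp [universalRTerm, pow_succ', ha]

end Eigenvalue

lemma prod_alpha_div_alpha (hq : IsPrimitiveRoot q n) (hℓ : ℓ ≤ n) (hi : i < ℓ) :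
    ∏ j ∈ Finset.range i, (alpha q (i - j) ℓ / alpha q (j + 1) ℓ) = 1 := by
  have hreflect := Finset.prod_range_reflect (fun j => alpha q (j + 1) ℓ) i
  rw [Finset.prod_div_distrib, ← hreflect, div_eq_one_iff_eq]
  · refine Finset.prod_congr rfl fun j hj => ?_
    rw [Finset.mem_range] at hj
    congr 1
    omega
  · rw [hreflect]
    refine Finset.prod_ne_zero_iff.mpr fun j hj => alpha_ne_zero hq j.succ_pos ?_ hℓ
    rw [Finset.mem_range] at hj
    omega

lemma prod_zpow_sq (h0 : q ≠ 0) (c : ℤ) (m : ℕ) :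
    (∏ j ∈ Finset.range m, q ^ (c + j)) ^ 2 = q ^ ((m : ℤ) * (2 * c + m - 1)) := by
  induction m with
  | zero => simp
  | succ m ih =>
    rw [Finset.prod_range_succ, mul_pow, ih, ← zpow_natCast, ← zpow_mul, ← zpow_add₀ h0]
    congr 1
    push_cast
    ring

section RCheck

variable [NeZero n] (hn : 2 ≤ n) (hq : IsPrimitiveRoot q n) (hℓ : ℓ ≤ n) (r : ZMod n)

lemma coord_row_comm (p p' : ℕ) (y : (Fin ℓ → k) ⊗[k] (Fin ℓ → k)) :
    coord k ℓ p (row k ℓ _ p' (TensorProduct.comm k _ _ y)) = coord k ℓ p' (row k ℓ _ p y) := by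
  induction y with
  | zero => simp
  | add y z hy hz => simp only [map_add, hy, hz]
  | tmul v w => simp [mul_comm]

lemma coord_row_rCheck (p : ℕ) (y : (Fin ℓ → k) ⊗[k] (Fin ℓ → k)) :
    coord k ℓ 0 (row k ℓ _ p (rCheck (simpleModule hn hq hℓ r) y)) =
      q ^ ((r.val : ℤ) * (p + 1 - (r.val + ℓ))) * coord k ℓ p (row k ℓ _ 0 y) := by
  let ρ := simpleModule hn hq hℓ r
  let one : Module.End k (Fin ℓ → k) := 1
  let φ := coord k ℓ p ∘ₗ row k ℓ (Fin ℓ → k) 0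
  have ha (v) : φ (TensorProduct.map (ρ (D.of n q .a)) one v) = 0 := by
    simp only [φ, ρ, one, LinearMap.comp_apply]
    rw [row_map (t := 0) (p' := 0) (by rw [coord_zero_comp_a, zero_smul]), zero_smul, map_zero]
  have hb (v) : φ (TensorProduct.map (ρ (D.of n q .b)) one v) = q ^ r.val * φ v := by
    simp only [φ, ρ, one, LinearMap.comp_apply]
    rw [row_map (coord_comp_b hn hq hℓ r 0), map_smul, Nat.cast_zero, add_zero, zpow_natCast]
    rfl
  have hc (v) : φ (TensorProduct.map one (ρ (D.of n q .c)) v) =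
      q ^ ((p : ℤ) + 1 - (r.val + ℓ)) * φ v := by
    simp only [φ, ρ, one, LinearMap.comp_apply, row_map_one]
    rw [← LinearMap.comp_apply, coord_comp_c]
    rfl
  calc coord k ℓ 0 (row k ℓ _ p (rCheck ρ y))
    _ = φ (outerAction ρ ρ (rMatrix n q) y) := coord_row_comm _ _ _
    _ = q ^ ((r.val : ℤ) * (p + 1 - (r.val + ℓ))) * φ y := by
      rw [outerAction_rMatrix, apply_universalR ha hb hc,
        cartan_pow_left hq (zpow_pow_eq_one hq _), ← zpow_natCast, ← zpow_mul, mul_comm (r.val : ℤ)]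

/-- The scalar by which `Ř` acts on the summand of `V(ℓ,r) ⊗ V(ℓ,r)` generated by
`lowestVec q ℓ r i`. -/
noncomputable def rCheckEigenvalue {n : ℕ} (q : k) (ℓ : ℕ) (r : ZMod n) (i : ℕ) : k :=
  q ^ ((r.val : ℤ) * (i + 1 - (r.val + ℓ))) / lowestCoeff q ℓ r i i

include hq hℓ in
lemma lowestCoeff_self_sq (hi : i < ℓ) :
    lowestCoeff q ℓ r i i ^ 2 = q ^ ((i : ℤ) * (2 * r.val + 2 * ℓ - i - 1)) := by
  have hexp (j : ℕ) : (r.val : ℤ) + ℓ + j - i = r.val + ℓ - i + j := by ring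
  simp only [lowestCoeff, Finset.prod_neg, Finset.prod_mul_distrib,
    prod_alpha_div_alpha hq hℓ hi, one_mul, mul_pow, hexp, ← pow_mul, mul_comm _ 2]
  rw [prod_zpow_sq (hq.ne_zero (NeZero.ne n))]
  simp only [pow_mul, neg_one_sq, one_pow, one_mul]
  congr 1
  ring

include hq hℓ in
lemma lowestCoeff_self_ne_zero (hi : i < ℓ) : lowestCoeff q ℓ r i i ≠ 0 := by
  have h := lowestCoeff_self_sq hq hℓ r hi
  exact fun h0 => zpow_ne_zero _ (hq.ne_zero (NeZero.ne n)) (by rw [← h, h0, zero_pow two_ne_zero])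

lemma rCheck_lowestVec (hi : i < ℓ) :
    rCheck (simpleModule hn hq hℓ r) (lowestVec q ℓ r i) =
      rCheckEigenvalue q ℓ r i • lowestVec q ℓ r i := by
  have hcomm (x : Gen) (y) := LinearMap.congr_fun
    (rCheck_mul_tensorModule hq (simpleModule hn hq hℓ r) (D.of n q x)) y
  simp only [Module.End.mul_apply] at hcomm
  obtain ⟨t, ht⟩ := exists_eq_smul_lowestVec hn hq hℓ (r := r) hi
    (by rw [← hcomm, squareModule_d_lowestVec hn hq hℓ r hi, map_zero])
    (by rw [← hcomm, squareModule_b_lowestVec hn hq hℓ r hi, map_smul])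
  have hcoord := coord_row_rCheck hn hq hℓ r i (lowestVec q ℓ r i)
  rw [ht, map_smul, map_smul, row_lowestVec r hi, row_zero_lowestVec r hi, map_smul, Nat.sub_self,
    coord_stdVec (by omega), coord_stdVec hi, if_pos rfl, if_pos rfl, smul_eq_mul, smul_eq_mul,
    mul_one, mul_one] at hcoord
  rw [ht, rCheckEigenvalue, ← hcoord, mul_div_cancel_right₀ _ (lowestCoeff_self_ne_zero hq hℓ r hi)]

lemma exists_val_eq (r : ZMod n) (i : ℕ) :
    ∃ t : ℤ, ((2 * r + i : ZMod n).val : ℤ) = 2 * r.val + i + n * t := by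
  have h : (((2 * r + i : ZMod n).val : ℤ) : ZMod n) = ((2 * r.val + i : ℤ) : ZMod n) := by
    push_cast
    simp
  rw [ZMod.intCast_eq_intCast_iff_dvd_sub] at h
  obtain ⟨t, ht⟩ := h
  exact ⟨-t, by linear_combination -ht⟩

include hq hℓ in
lemma rCheckEigenvalue_sq (hodd : Odd n) (hi : i < ℓ) :
    rCheckEigenvalue q ℓ r i ^ 2 = cScalar q ℓ r (2 * ℓ - 1 - 2 * i, 2 * r + i) := by
  rw [rCheckEigenvalue, div_pow, lowestCoeff_self_sq hq hℓ r hi, ← zpow_natCast, ← zpow_mul,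
    ← zpow_sub₀ (hq.ne_zero (NeZero.ne n)), cScalar]
  refine zpow_eq_of_dvd_sub hq ?_
  obtain ⟨t, ht⟩ := exists_val_eq r i
  obtain ⟨h, hh⟩ := hodd
  have hA : ((2 * ℓ - 1 - 2 * i : ℕ) : ℤ) = 2 * ℓ - 1 - 2 * i := by omega
  have hhalf : ((n : ℤ) - 1) / 2 = h := by omega
  have hnh : (n : ℤ) = 2 * h + 1 := by exact_mod_cast hh
  simp only [hA, ht, hhalf]
  refine ⟨t * (2 * (2 * r.val + i) + n * t + (2 * ℓ - 1 - 2 * i) - 1) + (ℓ - 1 - i), ?_⟩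
  push_cast
  linear_combination (-(ℓ : ℤ) + 1 + i) * hnh

end RCheck

end LowestVectors

section LowestMap

variable {k : Type*} [Field k] {n : ℕ} {q : k} {W : Type*} [AddCommGroup W] [Module k W]

lemma Satisfies.d_mul_a_pow_apply {f : Gen → Module.End k W} (hf : Satisfies n q f) (h0 : q ≠ 0)
    (h1 : q ≠ 1) {w : W} {A : ℕ} (hd : f .d w = 0)
    (hbc : f .b (f .c w) = q ^ (1 - (A : ℤ)) • w) (j : ℕ) :
    f .d ((f .a ^ (j + 1)) w) = alpha q (j + 1) A • (f .a ^ j) w := by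
  have h := LinearMap.congr_fun (hf.d_mul_a_pow j) w
  simp only [Module.End.mul_apply, LinearMap.add_apply, LinearMap.smul_apply, hd, map_zero,
    smul_zero, zero_add, LinearMap.sub_apply, Module.End.one_apply, hbc, map_sub, map_smul] at h
  have hcoeff : qInt q (j + 1) * (1 - q ^ j * q ^ (1 - (A : ℤ))) = alpha q (j + 1) A := by
    have h2 : q - 1 ≠ 0 := sub_ne_zero.mpr h1
    have h3 : qInt q (j + 1) * (q - 1) = q ^ (j + 1) - 1 := geom_sum_mul q (j + 1)
    rw [alpha, ← h3, ← zpow_natCast q j, ← zpow_add₀ h0]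
    field_simp
    congr 3
    push_cast
    ring
  rw [h, ← hcoeff, mul_smul, sub_smul, one_smul, mul_smul]

/-- The linear map `V(A,s) → W`, `v_{j+1} ↦ T^j w`; for a vector `w` of a `D_n`-module `W` and the
action `T` of `a` it is the candidate for the `D_n`-linear map with `v_1 ↦ w`. -/
noncomputable def lowestMap (T : Module.End k W) (w : W) (A : ℕ) : (Fin A → k) →ₗ[k] W :=
  (Pi.basisFun k (Fin A)).constr k fun j => (T ^ (j : ℕ)) w

lemma lowestMap_stdVec {T : Module.End k W} {w : W} {A j : ℕ} (hj : j < A) :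
    lowestMap T w A (stdVec k A j) = (T ^ j) w := by
  rw [stdVec_of_lt hj]
  exact Module.Basis.constr_basis _ _ _ _

lemma intertwines_of_gen {U : Type*} [AddCommGroup U] [Module k U]
    {ρ : D n q →ₐ[k] Module.End k U} {τ : D n q →ₐ[k] Module.End k W} {f : U →ₗ[k] W}
    (h : ∀ x, f ∘ₗ ρ (D.of n q x) = τ (D.of n q x) ∘ₗ f) (x : D n q) :
    f ∘ₗ ρ x = τ x ∘ₗ f := by
  induction x using D.induction with
  | of x => exact h x
  | algebraMap t => ext v; simp [Algebra.algebraMap_eq_smul_one]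
  | add x y hx hy =>
    rw [map_add, map_add, LinearMap.comp_add, LinearMap.add_comp, hx, hy]
  | mul x y hx hy =>
    rw [map_mul, map_mul, Module.End.mul_eq_comp, Module.End.mul_eq_comp, ← LinearMap.comp_assoc,
      hx, LinearMap.comp_assoc, hy, LinearMap.comp_assoc]

lemma apply_pow_of_qcomm {S T : Module.End k W} (h : S * T = q • (T * S)) {w : W} {t : k}
    (hw : S w = t • w) (j : ℕ) : S ((T ^ j) w) = (q ^ j * t) • (T ^ j) w := by
  have hj := LinearMap.congr_fun (mul_pow_of_qcomm h j) w
  simpa only [Module.End.mul_apply, LinearMap.smul_apply, hw, map_smul, smul_smul] using hj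

lemma satisfies_action (τ : D n q →ₐ[k] Module.End k W) :
    Satisfies n q (fun x => τ (D.of n q x)) :=
  (D.satisfies n q).map τ

lemma lowestMap_intertwines (hn : 2 ≤ n) (hq : IsPrimitiveRoot q n) {A : ℕ} (hA : A ≤ n)
    (s : ZMod n) (τ : D n q →ₐ[k] Module.End k W) {w : W} (hd : τ (D.of n q .d) w = 0)
    (hb : τ (D.of n q .b) w = q ^ (s.val : ℤ) • w)
    (hc : τ (D.of n q .c) w = q ^ (1 - ((s.val : ℤ) + A)) • w)
    (ha : (τ (D.of n q .a) ^ A) w = 0) (x : D n q) :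
    lowestMap (τ (D.of n q .a)) w A ∘ₗ simpleModule hn hq hA s x =
      τ x ∘ₗ lowestMap (τ (D.of n q .a)) w A := by
  have h0 : q ≠ 0 := hq.ne_zero (by omega)
  have hτ := satisfies_action τ
  refine intertwines_of_gen (fun x => stdVec_ext fun j hj => ?_) x
  rw [LinearMap.comp_apply, LinearMap.comp_apply, lowestMap_stdVec hj]
  cases x with
  | a =>
    rw [simpleModule_a_stdVec, ← Module.End.mul_apply, ← pow_succ']
    rcases Nat.lt_or_ge (j + 1) A with h | h
    · rw [lowestMap_stdVec h]
    · rw [stdVec_of_le h, map_zero, show j + 1 = A by omega, ha]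
  | b =>
    rw [simpleModule_b_stdVec, map_smul, lowestMap_stdVec hj, apply_pow_of_qcomm hτ.ba hb,
      zpow_add₀ h0, zpow_natCast q j, mul_comm]
  | c =>
    rw [simpleModule_c_stdVec, map_smul, lowestMap_stdVec hj, apply_pow_of_qcomm hτ.ca hc,
      ← zpow_natCast q j, ← zpow_add₀ h0, add_sub_assoc]
  | d =>
    rw [simpleModule_d_stdVec, map_smul]
    rcases j with _ | j
    · rw [alpha_zero, zero_smul, pow_zero, Module.End.one_apply, hd]
    · rw [Nat.add_sub_cancel, lowestMap_stdVec (by omega)]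
      refine (hτ.d_mul_a_pow_apply h0 (hq.ne_one (by omega)) hd ?_ j).symm
      rw [hc, map_smul, hb, smul_smul, ← zpow_add₀ h0]
      congr 2
      ring

lemma eq_zero_of_pow_apply_eq_zero {T : Module.End k W} {S : Submodule k W}
    (hS : ∀ u ∈ S, T u ∈ S) (h : ∀ u ∈ S, T u = 0 → u = 0) (m : ℕ) {u : W} (hu : u ∈ S)
    (hm : (T ^ m) u = 0) : u = 0 := by
  induction m generalizing u with
  | zero => exact hm
  | succ m ih =>
    exact h u hu (ih (hS u hu) (by rwa [← Module.End.mul_apply, ← pow_succ]))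

end LowestMap

section Decomposition

variable {k : Type*} [Field k] {n : ℕ} [NeZero n] {q : k} (hn : 2 ≤ n) (hq : IsPrimitiveRoot q n)
  {ℓ i : ℕ} (hℓ : ℓ ≤ n) (hℓ2 : 2 * ℓ ≤ n + 1) (r : ZMod n)

lemma squareModule_d_a_pow_lowestVec (hi : i < ℓ) (j : ℕ) :
    squareModule hn hq hℓ r (D.of n q .d)
        ((squareModule hn hq hℓ r (D.of n q .a) ^ (j + 1)) (lowestVec q ℓ r i)) =
      alpha q (j + 1) (2 * ℓ - 1 - 2 * i) •
        (squareModule hn hq hℓ r (D.of n q .a) ^ j) (lowestVec q ℓ r i) := by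
  have h0 : q ≠ 0 := hq.ne_zero (NeZero.ne n)
  have hA : ((2 * ℓ - 1 - 2 * i : ℕ) : ℤ) = 2 * ℓ - 1 - 2 * i := by omega
  refine (satisfies_action (squareModule hn hq hℓ r)).d_mul_a_pow_apply h0
    (hq.ne_one (by omega)) (squareModule_d_lowestVec hn hq hℓ r hi) ?_ j
  rw [squareModule_c_lowestVec hn hq hℓ r hi, map_smul, squareModule_b_lowestVec hn hq hℓ r hi,
    smul_smul, ← zpow_add₀ h0, hA]
  congr 2
  ring

include hℓ2 in
lemma squareModule_a_pow_lowestVec (hi : i < ℓ) :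
    (squareModule hn hq hℓ r (D.of n q .a) ^ (2 * ℓ - 1 - 2 * i)) (lowestVec q ℓ r i) = 0 := by
  have hS := satisfies_action (squareModule hn hq hℓ r)
  obtain ⟨B, hB⟩ : ∃ B, 2 * ℓ - 1 - 2 * i = B + 1 := ⟨2 * ℓ - 2 - 2 * i, by omega⟩
  rcases lt_or_ge (2 * ℓ - 1 - i) n with hN | hN
  · refine eq_zero_of_weight_ge hn hq hℓ (r := r) (N := 2 * ℓ - 1 - i) (by omega) hN ?_ ?_
    · rw [hB, squareModule_d_a_pow_lowestVec hn hq hℓ r hi, hB, alpha_self, zero_smul]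
    · rw [apply_pow_of_qcomm hS.ba (squareModule_b_lowestVec hn hq hℓ r hi), ← zpow_natCast q,
        ← zpow_add₀ (hq.ne_zero (NeZero.ne n))]
      congr 2
      omega
  · rw [show 2 * ℓ - 1 - 2 * i = n by omega, hS.a_pow, LinearMap.zero_apply]

omit [NeZero n] in
include hℓ2 in
lemma summand_dim_le (i : ℕ) : 2 * ℓ - 1 - 2 * i ≤ n := by omega

/-- The embedding of `V(2ℓ-1-2i, 2r+i)` into `V(ℓ,r) ⊗ V(ℓ,r)`. -/
noncomputable def summandMap (i : ℕ) :
    (Fin (2 * ℓ - 1 - 2 * i) → k) →ₗ[k] (Fin ℓ → k) ⊗[k] (Fin ℓ → k) :=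
  lowestMap (squareModule hn hq hℓ r (D.of n q .a)) (lowestVec q ℓ r i) (2 * ℓ - 1 - 2 * i)

lemma summandMap_intertwines (hi : i < ℓ) (x : D n q) :
    summandMap hn hq hℓ r i ∘ₗ simpleModule hn hq (summand_dim_le hℓ2 i) (2 * r + i : ZMod n) x =
      squareModule hn hq hℓ r x ∘ₗ summandMap hn hq hℓ r i := by
  obtain ⟨t, ht⟩ := exists_val_eq r i
  have hA : ((2 * ℓ - 1 - 2 * i : ℕ) : ℤ) = 2 * ℓ - 1 - 2 * i := by omega
  refine lowestMap_intertwines hn hq (summand_dim_le hℓ2 i) _ _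
    (squareModule_d_lowestVec hn hq hℓ r hi) ?_ ?_
    (squareModule_a_pow_lowestVec hn hq hℓ hℓ2 r hi) x
  · rw [squareModule_b_lowestVec hn hq hℓ r hi]
    exact congrArg (· • _) (zpow_eq_of_dvd_sub hq ⟨-t, by rw [ht]; ring⟩)
  · rw [squareModule_c_lowestVec hn hq hℓ r hi]
    exact congrArg (· • _) (zpow_eq_of_dvd_sub hq ⟨t, by rw [ht, hA]; ring⟩)

/-- The sum of the embeddings `V(2ℓ-1-2i, 2r+i) → V(ℓ,r) ⊗ V(ℓ,r)`, `0 ≤ i < ℓ`. -/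
noncomputable def squareMap :
    ((i : Fin ℓ) → Fin (2 * ℓ - 1 - 2 * i) → k) →ₗ[k] (Fin ℓ → k) ⊗[k] (Fin ℓ → k) :=
  ∑ i : Fin ℓ, summandMap hn hq hℓ r i ∘ₗ LinearMap.proj i

/-- The action of `D_n` on the direct sum of the modules `V(2ℓ-1-2i, 2r+i)`, `0 ≤ i < ℓ`. -/
noncomputable def summandsAction (x : D n q) :
    Module.End k ((i : Fin ℓ) → Fin (2 * ℓ - 1 - 2 * i) → k) :=
  LinearMap.pi fun i => simpleModule hn hq (summand_dim_le hℓ2 i)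
    (2 * r + ((i : ℕ) : ZMod n)) x ∘ₗ LinearMap.proj i

omit [NeZero n] in
lemma summandsAction_d_pow : summandsAction hn hq hℓ2 r (D.of n q .d) ^ n = 0 := by
  have hpow (m : ℕ) (x : D n q) :
      summandsAction hn hq hℓ2 r x ^ m = summandsAction hn hq hℓ2 r (x ^ m) := by
    induction m with
    | zero => refine LinearMap.ext fun u => funext fun i => ?_; simp [summandsAction]
    | succ m ih =>
      rw [pow_succ, ih, pow_succ]
      refine LinearMap.ext fun u => funext fun i => ?_
      simp [summandsAction]
  rw [hpow, (D.satisfies n q).d_pow]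
  refine LinearMap.ext fun u => funext fun i => ?_
  simp [summandsAction]

lemma squareMap_intertwines (x : D n q) :
    squareMap hn hq hℓ r ∘ₗ summandsAction hn hq hℓ2 r x =
      squareModule hn hq hℓ r x ∘ₗ squareMap hn hq hℓ r := by
  refine LinearMap.ext fun u => ?_
  simp only [squareMap, LinearMap.comp_apply, LinearMap.sum_apply, map_sum]
  exact Finset.sum_congr rfl fun i _ =>
    LinearMap.congr_fun (summandMap_intertwines hn hq hℓ hℓ2 r i.isLt x) (u i)

omit [NeZero n] in
lemma sum_smul_lowestVec_eq_zero {y : Fin ℓ → k} (h : ∑ i, y i • lowestVec q ℓ r i = 0)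
    (i : Fin ℓ) : y i = 0 := by
  have hi := congrArg (fun z => coord k ℓ i (row k ℓ _ 0 z)) h
  simpa [row_zero_lowestVec, coord_stdVec, Fin.ext_iff, ← Fin.ext_iff] using hi

lemma squareMap_eq_zero_of_d_eq_zero {u : (i : Fin ℓ) → Fin (2 * ℓ - 1 - 2 * i) → k}
    (hu : squareMap hn hq hℓ r u = 0)
    (hd : summandsAction hn hq hℓ2 r (D.of n q .d) u = 0) : u = 0 := by
  have hlow (i : Fin ℓ) : u i = coord k _ 0 (u i) • stdVec k _ 0 :=
    eq_smul_stdVec_zero_of_d_eq_zero hn hq (summand_dim_le hℓ2 i) (congrFun hd i)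
  have hsum : ∑ i : Fin ℓ, coord k _ 0 (u i) • lowestVec q ℓ r i = 0 := by
    rw [← hu, squareMap, LinearMap.sum_apply]
    refine Finset.sum_congr rfl fun i _ => ?_
    rw [LinearMap.comp_apply, LinearMap.proj_apply]
    conv_rhs => rw [hlow i]
    rw [map_smul, summandMap, lowestMap_stdVec (by omega), pow_zero, Module.End.one_apply]
  funext i
  rw [hlow i, sum_smul_lowestVec_eq_zero r hsum i, zero_smul, Pi.zero_apply]

include hℓ2 in
lemma squareMap_injective : Function.Injective (squareMap hn hq hℓ r) := by
  refine LinearMap.ker_eq_bot.mp ((Submodule.eq_bot_iff _).mpr fun u hu => ?_)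
  refine eq_zero_of_pow_apply_eq_zero (T := summandsAction hn hq hℓ2 r (D.of n q .d))
    (fun u hu => ?_) (fun u hu => squareMap_eq_zero_of_d_eq_zero hn hq hℓ hℓ2 r hu) n hu ?_
  · rw [LinearMap.mem_ker, ← LinearMap.comp_apply, squareMap_intertwines, LinearMap.comp_apply,
      LinearMap.mem_ker.mp hu, map_zero]
  · rw [summandsAction_d_pow, LinearMap.zero_apply]

lemma sum_summand_dims (ℓ : ℕ) : ∑ i : Fin ℓ, (2 * ℓ - 1 - 2 * (i : ℕ)) = ℓ * ℓ := by
  have hterm (i : ℕ) (hi : i ∈ Finset.range ℓ) : 2 * ℓ - 1 - 2 * i = 2 * (ℓ - 1 - i) + 1 := by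
    rw [Finset.mem_range] at hi
    omega
  have sum_odd (m : ℕ) : ∑ i ∈ Finset.range m, (2 * i + 1) = m * m := by
    induction m with
    | zero => rfl
    | succ m ih => rw [Finset.sum_range_succ, ih]; ring
  rw [Fin.sum_univ_eq_sum_range (fun i => 2 * ℓ - 1 - 2 * i), Finset.sum_congr rfl hterm,
    Finset.sum_range_reflect (fun i => 2 * i + 1) ℓ, sum_odd]

include hℓ2 in
lemma squareMap_surjective : Function.Surjective (squareMap hn hq hℓ r) := by
  refine (LinearMap.injective_iff_surjective_of_finrank_eq_finrank ?_).mp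
    (squareMap_injective hn hq hℓ hℓ2 r)
  simp [Module.finrank_pi_fintype, Module.finrank_tensorProduct, sum_summand_dims]

lemma isSummand_square (hi : i < ℓ) :
    IsSummand (simpleModule hn hq (summand_dim_le hℓ2 i) (2 * r + i : ZMod n))
      (squareModule hn hq hℓ r) := by
  let e := LinearEquiv.ofBijective (squareMap hn hq hℓ r)
    ⟨squareMap_injective hn hq hℓ hℓ2 r, squareMap_surjective hn hq hℓ hℓ2 r⟩
  have he (u) : e u = squareMap hn hq hℓ r u := rfl
  refine ⟨summandMap hn hq hℓ r i, LinearMap.proj (⟨i, hi⟩ : Fin ℓ) ∘ₗ e.symm.toLinearMap,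
    summandMap_intertwines hn hq hℓ hℓ2 r hi, fun x => LinearMap.ext fun y => ?_,
    LinearMap.ext fun u => ?_⟩
  · obtain ⟨u, rfl⟩ := e.surjective y
    have h := LinearMap.congr_fun (squareMap_intertwines hn hq hℓ hℓ2 r x) u
    rw [LinearMap.comp_apply, LinearMap.comp_apply, ← he, ← he] at h
    simp only [LinearMap.comp_apply, LinearEquiv.coe_coe, ← h, LinearEquiv.symm_apply_apply]
    rfl
  · have h : summandMap hn hq hℓ r i u = e (Pi.single (⟨i, hi⟩ : Fin ℓ) u) := by
      rw [he, squareMap, LinearMap.sum_apply,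
        Finset.sum_eq_single_of_mem (⟨i, hi⟩ : Fin ℓ) (Finset.mem_univ _)
          fun j _ hj => by simp [hj]]
      simp
    simp [h]

include hℓ2 in
lemma mem_squareSummands (hi : i < ℓ) :
    (2 * ℓ - 1 - 2 * i, 2 * r + (i : ZMod n)) ∈ squareSummands hn hq hℓ r := by
  classical
  refine Finset.mem_filter.mpr ⟨?_, summand_dim_le hℓ2 i, isSummand_square hn hq hℓ hℓ2 r hi⟩
  rw [Finset.mem_product]
  exact ⟨Finset.mem_Icc.mpr ⟨show 1 ≤ 2 * ℓ - 1 - 2 * i by omega, summand_dim_le hℓ2 i⟩,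
    Finset.mem_univ _⟩

lemma rCheck_summandMap (hi : i < ℓ) (u : Fin (2 * ℓ - 1 - 2 * i) → k) :
    rCheck (simpleModule hn hq hℓ r) (summandMap hn hq hℓ r i u) =
      rCheckEigenvalue q ℓ r i • summandMap hn hq hℓ r i u := by
  suffices rCheck (simpleModule hn hq hℓ r) ∘ₗ summandMap hn hq hℓ r i =
    rCheckEigenvalue q ℓ r i • summandMap hn hq hℓ r i from LinearMap.congr_fun this u
  refine stdVec_ext fun j hj => ?_
  have h : Commute (rCheck (simpleModule hn hq hℓ r)) (squareModule hn hq hℓ r (D.of n q .a)) :=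
    rCheck_mul_tensorModule hq _ _
  rw [LinearMap.comp_apply, LinearMap.smul_apply, summandMap, lowestMap_stdVec hj,
    ← Module.End.mul_apply, (h.pow_right j).eq, Module.End.mul_apply,
    rCheck_lowestVec hn hq hℓ r hi, map_smul]

include hℓ2 in
lemma aeval_rCheck (hodd : Odd n) :
    Polynomial.aeval (rCheck (simpleModule hn hq hℓ r))
      (∏ U ∈ squareSummands hn hq hℓ r,
        (Polynomial.X ^ 2 - Polynomial.C (cScalar q ℓ r U))) = 0 := by
  refine LinearMap.ext fun y => ?_
  obtain ⟨u, rfl⟩ := squareMap_surjective hn hq hℓ hℓ2 r y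
  rw [LinearMap.zero_apply, squareMap, LinearMap.sum_apply, map_sum]
  refine Finset.sum_eq_zero fun i _ => ?_
  rw [LinearMap.comp_apply,
    Module.End.aeval_apply_of_mem_apply_eq_smul (rCheck_summandMap hn hq hℓ r i.isLt _),
    Polynomial.eval_prod, Finset.prod_eq_zero (mem_squareSummands hn hq hℓ hℓ2 r i.isLt),
    zero_smul]
  simp [rCheckEigenvalue_sq hq hℓ r hodd i.isLt]

end Decomposition

section TensorPowers

variable {k : Type*} [Field k] {V : Type*} [AddCommGroup V] [Module k V]

/-- `atSlots` as a homomorphism of algebras. -/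
noncomputable def atSlotsHom {m i : ℕ} (h1 : 1 ≤ i) (h2 : i + 1 ≤ m) :
    Module.End k (V ⊗[k] V) →ₐ[k] Module.End k (⨂[k]^m V) :=
  ((splitSlots k V h1 h2).conjAlgEquiv k).toAlgHom.comp
    ((Module.End.rTensorAlgHom k ((⨂[k]^(i - 1) V) ⊗[k] (V ⊗[k] V))
      (⨂[k]^(m - i - 1) V)).comp
        (Module.End.lTensorAlgHom k (V ⊗[k] V) (⨂[k]^(i - 1) V)))

lemma atSlotsHom_apply {m i : ℕ} (h1 : 1 ≤ i) (h2 : i + 1 ≤ m) (T : Module.End k (V ⊗[k] V)) :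
    atSlotsHom h1 h2 T = atSlots h1 h2 T := rfl

end TensorPowers

end TaftDouble

theorem proposition4p4_general {k : Type*} [Field k] {n : ℕ} [NeZero n] (hn2 : 2 ≤ n)
    (hodd : Odd n) {q : k} (hq : IsPrimitiveRoot q n) {ℓ : ℕ} (hℓn : ℓ ≤ n) (hℓ : 2 * ℓ ≤ n + 1)
    (r : ZMod n) {m i : ℕ} (hi : 1 ≤ i) (him : i + 1 ≤ m) :
    Polynomial.aeval (TaftDouble.rCheckAt (TaftDouble.simpleModule hn2 hq hℓn r) hi him)
        (∏ U ∈ TaftDouble.squareSummands hn2 hq hℓn r,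
          (Polynomial.X ^ 2 - Polynomial.C (TaftDouble.cScalar q ℓ r U))) = 0 ∧
      ∀ μ : k, Module.End.HasEigenvalue
          (TaftDouble.rCheckAt (TaftDouble.simpleModule hn2 hq hℓn r) hi him) μ →
        ∃ U ∈ TaftDouble.squareSummands hn2 hq hℓn r,
          ∃ t : k, t ^ 2 = TaftDouble.cScalar q ℓ r U ∧ (μ = t ∨ μ = -t) := by
  have annihilates :
      Polynomial.aeval (TaftDouble.rCheckAt (TaftDouble.simpleModule hn2 hq hℓn r) hi him)
        (∏ U ∈ TaftDouble.squareSummands hn2 hq hℓn r,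
          (Polynomial.X ^ 2 - Polynomial.C (TaftDouble.cScalar q ℓ r U))) = 0 := by
    rw [TaftDouble.rCheckAt, ← TaftDouble.atSlotsHom_apply, Polynomial.aeval_algHom_apply,
      TaftDouble.aeval_rCheck hn2 hq hℓn hℓ r hodd, map_zero]
  refine ⟨annihilates, fun μ hμ => ?_⟩
  have root := (Module.End.isRoot_of_hasEigenvalue hμ).dvd (minpoly.dvd k _ annihilates)
  rw [Polynomial.IsRoot.def, Polynomial.eval_prod, Finset.prod_eq_zero_iff] at root
  obtain ⟨U, hU, hμU⟩ := root
  exact ⟨U, hU, μ, by simpa [sub_eq_zero] using hμU, Or.inl rfl⟩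

-- `Ř_i` acts on `V(ℓ,r)^{⊗m}`. The product of the pairwise commuting operators `Ř_i² - c_U id` is
-- the value at `Ř_i` of the polynomial `∏_U (X² - c_U)`.
theorem proposition4p4 {k : Type*} [Field k] [IsAlgClosed k] [CharZero k]
    {n : ℕ} [NeZero n] (hn2 : 2 ≤ n) (hn : 3 ≤ n) (hodd : Odd n)
    {q : k} (hq : IsPrimitiveRoot q n)
    {ℓ : ℕ} (hℓ1 : 1 ≤ ℓ) (hℓn : ℓ ≤ n) (hℓ : 2 * ℓ ≤ n + 1) (r : ZMod n)
    {m i : ℕ} (hi : 1 ≤ i) (him : i + 1 ≤ m) :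
    Polynomial.aeval (TaftDouble.rCheckAt (TaftDouble.simpleModule hn2 hq hℓn r) hi him)
        (∏ U ∈ TaftDouble.squareSummands hn2 hq hℓn r,
          (Polynomial.X ^ 2 - Polynomial.C (TaftDouble.cScalar q ℓ r U))) = 0 ∧
      ∀ μ : k, Module.End.HasEigenvalue
          (TaftDouble.rCheckAt (TaftDouble.simpleModule hn2 hq hℓn r) hi him) μ →
        ∃ U ∈ TaftDouble.squareSummands hn2 hq hℓn r,
          ∃ t : k, t ^ 2 = TaftDouble.cScalar q ℓ r U ∧ (μ = t ∨ μ = -t) := by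
  exact proposition4p4_general hn2 hodd hq hℓn hℓ r hi him
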